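/- Let $(X,d)$ be a complete separable metric space, let $\mathfrak m$ be a nonzero Borel measure on $X$ that is finite on bounded sets, and let $1\le p<\infty$. Let $\mathcal L^p(X)$ be the set of $\mathfrak m$-measurable functions $u\colon X\to\mathbb R$ with $\int|u|^p\,d\mathfrak m<\infty$, and $L^p(X)$ its quotient by equality $\mathfrak m$-almost everywhere. For $u\in\mathcal L^p(X)$ define three energies with values in $[0,+\infty]$, where $\inf\emptyset=+\infty$. * $F_{curve}(u)=\inf\|g\|_{L^p}$ over all upper gradients $g$ of $u$, i.e. Borel functions $g\colon X\to[0,\infty]$ such that $|u(\gamma(b))-u(\gamma(a))|\le\int_\gamma g$ for every rectifiable curve $\gamma\colon[a,b]\to X$, where $\int_\gamma g$ is the integral of $g$ with respect to arc length. * $F_{AGS}(u)=\|\mathrm{lip}\,u\|_{L^p}$ if $u$ is Lipschitz and $F_{AGS}(u)=+\infty$ otherwise, where $\mathrm{lip}\,u(x)=\lim_{\varepsilon\to0}\sup\left\{\frac{|u(y)-u(x)|}{d(y,x)} : y\ne x,\ d(y,x)\le\varepsilon\right\}$ (with $\sup\emptyset=0$). * $F_{\mathcal C}(u)=\lim_{\varepsilon\to0}\inf\|g\|_{L^p}$,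 the infimum being over all $\varepsilon$-upper gradients $g$ of $u$, i.e. Borel functions $g\colon X\to[0,\infty]$ such that $$|u(q_N)-u(q_0)|\le\sum_{i=0}^{N-1}\frac{g(q_i)+g(q_{i+1})}2\,d(q_i,q_{i+1})$$ for all finite sequences of points $q_0,\dots,q_N$ of $X$ with $d(q_i,q_{i+1})\le\varepsilon$ for every $i<N$ (with $\infty\cdot0=0$). For each $F\in\{F_{\mathcal C},F_{AGS},F_{curve}\}$ and $u\in L^p(X)$ let $$\widetilde F(u)=\inf\left\{\liminf_{j\to\infty}F(u_j) : u_j\in\mathcal L^p(X),\ u_j\to u\text{ in }L^p(X)\right\},\qquad \|u\|_{F}=\left(\|u\|_{L^p}^p+\widetilde F(u)^p\right)^{1/p}\in[0,+\infty],$$ and let $H^{1,p}_{\mathcal C}(X)$, $H^{1,p}_{AGS}(X)$, $H^{1,p}_{curve}(X)$ be the corresponding spaces $\{u\in L^p(X):\widetilde F(u)<\infty\}$, with norm $\|\cdot\|_F$. Then $$H^{1,p}_{\mathcal C}(X)=H^{1,p}_{AGS}(X)=H^{1,p}_{curve}(X),$$ and $$\|u\|_{H^{1,p}_{\mathcal C}(X)}=\|u\|_{H^{1,p}_{AGS}(X)}=\|u\|_{H^{1,p}_{curve}(X)}\qquad\text{for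 every }u\in L^p(X).$$ -/

import Mathlib

open MeasureTheory Filter Topology
open scoped ENNReal

noncomputable section

namespace ChainSobolev

/-! ### Relaxation of a functional and the associated Sobolev space -/

section Relaxation

variable {X : Type*} [MeasurableSpace X]

/-- The relaxation of a functional `F` on `p`-integrable functions with respect to `L^p`
convergence: the infimum of `liminf F (v j)` over all sequences of `p`-integrable functions `v j`
(everywhere defined, that is, representatives) that converge to `u` in `L^p`. -/
def relaxation (p : ℝ≥0∞) (μ : Measure X) (F : (X → ℝ) → ℝ≥0∞) (u : Lp ℝ p μ) : ℝ≥0∞ :=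
  ⨅ (v : ℕ → X → ℝ) (_ : ∀ j, MemLp (v j) p μ)
    (_ : Tendsto (fun j => eLpNorm (fun x => v j x - u x) p μ) atTop (𝓝 0)),
    liminf (fun j => F (v j)) atTop

/-- The Sobolev space of a functional: the elements of `L^p` whose relaxed energy is finite. -/
def sobolevSpace (p : ℝ≥0∞) (μ : Measure X) (F : (X → ℝ) → ℝ≥0∞) : Set (Lp ℝ p μ) :=
  {u | relaxation p μ F u < ∞}

/-- The Sobolev norm of `u ∈ L^p`, namely `(‖u‖_{L^p} ^ p + (relaxed energy of u) ^ p) ^ (1 / p)`.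
It is finite exactly on the Sobolev space. -/
def sobolevNorm (p : ℝ≥0∞) (μ : Measure X) (F : (X → ℝ) → ℝ≥0∞) (u : Lp ℝ p μ) : ℝ≥0∞ :=
  (eLpNorm u p μ ^ p.toReal + relaxation p μ F u ^ p.toReal) ^ (1 / p.toReal)

end Relaxation

section Metric

variable {X : Type*} [MetricSpace X]

/-! ### The local Lipschitz constant -/

/-- The slope of `u` at size `ε`: the supremum of `|u y - u x| / d(y, x)` over the points `y ≠ x` of
the ball of radius `ε` (the point `y = x` contributes `0 / 0 = 0`). -/
def slopeAt (ε : ℝ) (u : X → ℝ) (x : X) : ℝ≥0∞ :=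
  ⨆ y ∈ Metric.closedBall x ε, ‖u y - u x‖ₑ / edist y x

/-- The local Lipschitz constant of `u`, the limit of the slopes as the size tends to `0`. The slope
is nondecreasing in the size, so that the limit is an infimum. -/
def lip (u : X → ℝ) (x : X) : ℝ≥0∞ :=
  ⨅ (ε : ℝ) (_ : 0 < ε), slopeAt ε u x

/-! ### Upper gradients along curves -/

/-- `γ`, restricted to `[a, b]`, is a rectifiable curve: continuous and of finite length. -/
def IsRectifiableCurve (γ : ℝ → X) (a b : ℝ) : Prop :=
  a < b ∧ ContinuousOn γ (Set.Icc a b) ∧ eVariationOn γ (Set.Icc a b) < ∞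

/-- The integral of `g` over a rectifiable curve `γ : [a, b] → X`: the integral over `[0, ℓ(γ)]` of
`g` composed with the arc-length parametrization of `γ`. -/
def curveLIntegral (g : X → ℝ≥0∞) (γ : ℝ → X) (a b : ℝ) : ℝ≥0∞ :=
  ∫⁻ t in Set.Icc 0 (eVariationOn γ (Set.Icc a b)).toReal,
    g (naturalParameterization γ (Set.Icc a b) a t)

/-! ### Upper gradients along chains -/

/-- The points `q 0, …, q N` form an `ε`-chain (the values of `q` beyond `N` play no role). -/
def IsChainOfSize (ε : ℝ) (N : ℕ) (q : ℕ → X) : Prop :=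
  ∀ i < N, dist (q i) (q (i + 1)) ≤ ε

/-- The integral of `g` along the chain `q 0, …, q N`. -/
def chainIntegral (g : X → ℝ≥0∞) (N : ℕ) (q : ℕ → X) : ℝ≥0∞ :=
  ∑ i ∈ Finset.range N, (g (q i) + g (q (i + 1))) / 2 * edist (q i) (q (i + 1))

variable [MeasurableSpace X]

/-- `g` is a (Borel) upper gradient of `u` along rectifiable curves. -/
def IsUpperGradient (u : X → ℝ) (g : X → ℝ≥0∞) : Prop :=
  Measurable g ∧ ∀ (γ : ℝ → X) (a b : ℝ), IsRectifiableCurve γ a b →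
    ‖u (γ b) - u (γ a)‖ₑ ≤ curveLIntegral g γ a b

/-- `g` is a (Borel) `ε`-upper gradient of `u`. -/
def IsChainUpperGradient (ε : ℝ) (u : X → ℝ) (g : X → ℝ≥0∞) : Prop :=
  Measurable g ∧ ∀ (N : ℕ) (q : ℕ → X), IsChainOfSize ε N q →
    ‖u (q N) - u (q 0)‖ₑ ≤ chainIntegral g N q

/-! ### The three energies -/

/-- The infimum of the `L^p` norms of the upper gradients of `u` along curves. -/
def curveEnergy (p : ℝ≥0∞) (μ : Measure X) (u : X → ℝ) : ℝ≥0∞ :=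
  ⨅ (g : X → ℝ≥0∞) (_ : IsUpperGradient u g), eLpNorm g p μ

open Classical in
/-- The `L^p` norm of the local Lipschitz constant on Lipschitz functions, `∞` elsewhere. -/
def agsEnergy (p : ℝ≥0∞) (μ : Measure X) (u : X → ℝ) : ℝ≥0∞ :=
  if ∃ K, LipschitzWith K u then eLpNorm (lip u) p μ else ∞

/-- The infimum of the `L^p` norms of the `ε`-upper gradients of `u`. -/
def chainEnergyAt (p : ℝ≥0∞) (μ : Measure X) (ε : ℝ) (u : X → ℝ) : ℝ≥0∞ :=
  ⨅ (g : X → ℝ≥0∞) (_ : IsChainUpperGradient ε u g), eLpNorm g p μ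

/-- The chain energy: the limit as `ε → 0` of the infimum of the `L^p` norms of the `ε`-upper
gradients, written as an infimum by monotonicity (see `tendsto_chainEnergyAt`). -/
def chainEnergy (p : ℝ≥0∞) (μ : Measure X) (u : X → ℝ) : ℝ≥0∞ :=
  ⨅ (ε : ℝ) (_ : 0 < ε), chainEnergyAt p μ ε u

theorem chainEnergyAt_mono (p : ℝ≥0∞) (μ : Measure X) (u : X → ℝ) {ε ε' : ℝ} (h : ε' ≤ ε) :
    chainEnergyAt p μ ε' u ≤ chainEnergyAt p μ ε u :=
  le_iInf₂ fun g hg => iInf₂_le g ⟨hg.1, fun N q hq => hg.2 N q fun i hi => (hq i hi).trans h⟩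

/-- The infimum that defines the chain energy is the limit as `ε → 0`. -/
theorem tendsto_chainEnergyAt (p : ℝ≥0∞) (μ : Measure X) (u : X → ℝ) :
    Tendsto (fun ε => chainEnergyAt p μ ε u) (𝓝[>] 0) (𝓝 (chainEnergy p μ u)) := by
  refine tendsto_order.2 ⟨fun c hc => ?_, fun c hc => ?_⟩
  · filter_upwards [self_mem_nhdsWithin] with ε hε
    exact hc.trans_le (iInf₂_le ε hε)
  · simp only [chainEnergy, iInf_lt_iff] at hc
    obtain ⟨ε, hε, h⟩ := hc
    filter_upwards [Ioc_mem_nhdsGT hε] with ε' hε'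
    exact (chainEnergyAt_mono p μ u hε'.2).trans_lt h

end Metric

end ChainSobolev

end

/-!
The three relaxed energies are compared through the energy of the local Lipschitz constant.

Two comparisons are soft. For continuous `u` the slope of `u` at a fixed size is an upper gradient
along chains of smaller mesh, because each step of a chain is controlled by the slopes at both of
its ends. Averaging Riemann sums over shifted equidistant times
(`IsChainUpperGradient.enorm_sub_le_curveLIntegral`) turns an inequality along chains into one along
rectifiable curves, as long as the upper gradient is finite at the end points. Applied to slopes of
decreasing size it shows that the local Lipschitz constant of a Lipschitz function is an upper
gradient (`curveEnergy_le_agsEnergy`). Slopes also bound the chain energy, once the function is cut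
off to have bounded support (`relaxation_chainEnergy_le_agsEnergy`).

The substance is the approximation of a function by Lipschitz functions whose local Lipschitz
constants cost no more than a given upper gradient. It is carried out for functions that satisfy the
upper gradient inequality only along curves whose end points are not poles
(`IsUpperGradientOffPoles`), since this covers upper gradients along curves and along chains.
After localization the measure is finite and `|u| ≤ M`. The upper gradient is replaced by a lower
semicontinuous majorant `G` of almost the same energy which is bounded away from `0` and larger than
`m` outside a compact set `K m`. Let `G n` increase to `G`, with `G n` being `n`-Lipschitz and
bounded, and let `K` be a compact set of almost full measure on which `u` is continuous and the upper
gradient is finite. The approximation `v n x` is the infimum of `u (q 0) + ∑ G n d` over all chains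
`q` of mesh `1 / (n + 1)` that lead from `K` to `x`, capped at `M` (`chainInf`). Dynamic programming
gives that `v n` is Lipschitz with `lip (v n) ≤ G n ≤ G`, and `v n ≤ u` on `K`.

If `v n x` stayed below `u x - c` for some `x ∈ K`, there would be chains of vanishing mesh from `K`
to `x` whose cost is too small. Their length is bounded because `G` is bounded below, and their union
is totally bounded because long excursions away from `K m` are expensive
(`totallyBounded_chains`). An ultrafilter limit yields a Lipschitz curve along which the
integral of `G` is at most the limit of the costs (`exists_limit_curve`), in contradiction with the
upper gradient inequality (`eventually_le_chainInf`). So `v n → u` on `K`, and dominated convergence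
concludes (`exists_lipschitz_approx`).
-/

open scoped NNReal

noncomputable section

namespace ChainSobolev

/-! ### Comparison of relaxed energies -/

section Relaxation

variable {X : Type*} [MeasurableSpace X]

/-- One relaxed energy is at most another as soon as every function of finite second energy can be
approximated in `L^p` by functions whose first energy is almost as small. -/
theorem relaxation_le_of_approx {p : ℝ≥0∞} (hp : 1 ≤ p) {μ : Measure X}
    {F G : (X → ℝ) → ℝ≥0∞}
    (h : ∀ v : X → ℝ, MemLp v p μ → F v < ∞ → ∀ η : ℝ≥0∞, 0 < η →
      ∃ w : X → ℝ, MemLp w p μ ∧ G w ≤ F v + η ∧ eLpNorm (fun x => w x - v x) p μ ≤ η)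
    (u : Lp ℝ p μ) : relaxation p μ G u ≤ relaxation p μ F u := by
  refine le_iInf fun v => le_iInf fun hv => le_iInf fun hlim => ?_
  have key : ∀ j : ℕ, ∃ w : X → ℝ, MemLp w p μ ∧ G w ≤ F (v j) + ((j : ℝ≥0∞) + 1)⁻¹ ∧
      eLpNorm (fun x => w x - v j x) p μ ≤ ((j : ℝ≥0∞) + 1)⁻¹ := by
    intro j
    rcases lt_or_ge (F (v j)) ∞ with hF | hF
    · exact h _ (hv j) hF _ (by simp [ENNReal.inv_pos])
    · refine ⟨v j, hv j, ?_, by simp⟩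
      rw [top_le_iff.1 hF]
      simp
  choose w hw hG hd using key
  have hδ : Tendsto (fun j : ℕ => ((j : ℝ≥0∞) + 1)⁻¹) atTop (𝓝 0) := by
    have := ENNReal.tendsto_inv_nat_nhds_zero.comp (tendsto_add_atTop_nat 1)
    refine this.congr fun j => by simp
  have hwu : Tendsto (fun j => eLpNorm (fun x => w j x - u x) p μ) atTop (𝓝 0) := by
    have hsum := hδ.add hlim
    rw [zero_add] at hsum
    refine tendsto_of_tendsto_of_tendsto_of_le_of_le tendsto_const_nhds hsum
      (fun _ => zero_le) fun j => ?_
    have : (fun x => w j x - u x) = (fun x => w j x - v j x) + fun x => v j x - u x := by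
      ext x; simp
    rw [this]
    refine (eLpNorm_add_le ((hw j).1.sub (hv j).1)
      ((hv j).1.sub (Lp.aestronglyMeasurable u)) hp).trans ?_
    exact add_le_add (hd j) le_rfl
  have hle : relaxation p μ G u ≤ liminf (fun j => G (w j)) atTop :=
    iInf_le_of_le w (iInf_le_of_le hw (iInf_le_of_le hwu le_rfl))
  refine (hle.trans (liminf_le_liminf (Eventually.of_forall hG))).trans ?_
  exact (ENNReal.liminf_add_of_right_tendsto_zero hδ _).le

end Relaxation

/-! ### Slopes and the local Lipschitz constant -/

section Slope

variable {X : Type*} [MetricSpace X]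

/-- The variant of `slopeAt` in which the supremum runs over an open ball; it is lower
semicontinuous, hence Borel, when `u` is continuous. -/
def openSlope (ε : ℝ) (u : X → ℝ) (x : X) : ℝ≥0∞ :=
  ⨆ y ∈ Metric.ball x ε, ‖u y - u x‖ₑ / edist y x

theorem openSlope_le_slopeAt (ε : ℝ) (u : X → ℝ) (x : X) : openSlope ε u x ≤ slopeAt ε u x :=
  biSup_mono fun _ hy => Metric.ball_subset_closedBall hy

theorem slopeAt_le_openSlope {ε δ : ℝ} (h : ε < δ) (u : X → ℝ) (x : X) :
    slopeAt ε u x ≤ openSlope δ u x :=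
  biSup_mono fun _ hy => Metric.closedBall_subset_ball h hy

theorem openSlope_mono {ε δ : ℝ} (h : ε ≤ δ) (u : X → ℝ) (x : X) :
    openSlope ε u x ≤ openSlope δ u x :=
  biSup_mono fun _ hy => Metric.ball_subset_ball h hy

theorem lowerSemicontinuous_openSlope (ε : ℝ) {u : X → ℝ} (hu : Continuous u) :
    LowerSemicontinuous (openSlope ε u) := by
  refine lowerSemicontinuous_iSup fun y => ?_
  rw [lowerSemicontinuous_iff_isOpen_preimage]
  intro c
  -- the supremum over the proposition `y ∈ ball x ε` exceeds `c` on an open set of points `x`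
  have : (fun x => ⨆ _ : y ∈ Metric.ball x ε, ‖u y - u x‖ₑ / edist y x) ⁻¹' Set.Ioi c =
      Metric.ball y ε ∩ {x | c * edist y x < ‖u y - u x‖ₑ} := by
    ext x
    simp only [Set.mem_preimage, Set.mem_Ioi, lt_iSup_iff, Set.mem_inter_iff, Set.mem_ofPred_eq,
      exists_prop, Metric.mem_ball, dist_comm y x]
    refine and_congr_right fun _ => ?_
    rcases eq_or_ne x y with rfl | hxy
    · simp
    · exact ENNReal.lt_div_iff_mul_lt (Or.inl (by simpa [edist_eq_zero] using hxy.symm))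
        (Or.inl (edist_ne_top _ _))
  rw [this]
  rcases eq_or_ne c ∞ with rfl | hc
  · convert isOpen_empty
    ext x
    rcases eq_or_ne x y with rfl | hxy
    · simp
    · have : edist y x ≠ 0 := by simpa [edist_eq_zero] using hxy.symm
      simp [ENNReal.top_mul this]
  · refine Metric.isOpen_ball.inter (isOpen_lt ?_ ?_)
    · exact (ENNReal.continuous_const_mul hc).comp (continuous_const.edist continuous_id)
    · exact (continuous_const.sub hu).enorm

theorem lip_le_openSlope {ε : ℝ} (hε : 0 < ε) (u : X → ℝ) (x : X) : lip u x ≤ openSlope ε u x :=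
  (iInf₂_le (ε / 2) (half_pos hε)).trans (slopeAt_le_openSlope (half_lt_self hε) u x)

theorem lip_eq_iInf_openSlope (u : X → ℝ) (x : X) :
    lip u x = ⨅ n : ℕ, openSlope (1 / ((n : ℝ) + 1)) u x := by
  refine le_antisymm (le_iInf fun n => lip_le_openSlope (by positivity) u x) ?_
  refine le_iInf₂ fun ε hε => ?_
  obtain ⟨n, hn⟩ := exists_nat_one_div_lt hε
  exact (iInf_le _ n).trans ((openSlope_mono hn.le u x).trans (openSlope_le_slopeAt ε u x))

theorem antitone_openSlope (u : X → ℝ) :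
    Antitone fun n : ℕ => openSlope (1 / ((n : ℝ) + 1)) u := fun _ _ h x =>
  openSlope_mono (one_div_le_one_div_of_le (by positivity) (by gcongr)) u x

theorem slopeAt_le_of_lipschitzWith {K : ℝ≥0} {u : X → ℝ} (hu : LipschitzWith K u) (ε : ℝ)
    (x : X) : slopeAt ε u x ≤ K := by
  refine iSup₂_le fun y _ => ENNReal.div_le_of_le_mul ?_
  rw [← edist_eq_enorm_sub]
  exact hu y x

theorem enorm_sub_le_slopeAt_mul {ε : ℝ} (u : X → ℝ) {x y : X} (h : dist y x ≤ ε) :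
    ‖u y - u x‖ₑ ≤ slopeAt ε u x * edist y x := by
  rcases eq_or_ne y x with rfl | hxy
  · simp
  · refine (ENNReal.div_le_iff (by simpa [edist_eq_zero] using hxy) (edist_ne_top _ _)).1 ?_
    exact le_iSup₂ (f := fun y (_ : y ∈ Metric.closedBall x ε) => ‖u y - u x‖ₑ / edist y x) y h

/-- The length of a real path is at least the distance between its ends. -/
theorem enorm_sub_le_sum (u : ℕ → ℝ) (N : ℕ) :
    ‖u N - u 0‖ₑ ≤ ∑ i ∈ Finset.range N, ‖u (i + 1) - u i‖ₑ := by
  rw [← Finset.sum_range_sub]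
  exact enorm_sum_le _ _

variable [MeasurableSpace X] [BorelSpace X]

theorem measurable_openSlope (ε : ℝ) {u : X → ℝ} (hu : Continuous u) :
    Measurable (openSlope ε u) :=
  (lowerSemicontinuous_openSlope ε hu).measurable

theorem measurable_lip {u : X → ℝ} (hu : Continuous u) : Measurable (lip u) := by
  rw [show lip u = fun x => ⨅ n : ℕ, openSlope (1 / ((n : ℝ) + 1)) u x from
    funext (lip_eq_iInf_openSlope u)]
  exact Measurable.iInf fun n => measurable_openSlope _ hu

theorem isChainUpperGradient_openSlope {ε δ : ℝ} (h : ε < δ) {u : X → ℝ} (hu : Continuous u) :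
    IsChainUpperGradient ε u (openSlope δ u) := by
  refine ⟨measurable_openSlope δ hu, fun N q hq => (enorm_sub_le_sum (u ∘ q) N).trans ?_⟩
  refine Finset.sum_le_sum fun i hi => ?_
  have hd := hq i (Finset.mem_range.1 hi)
  have h1 : ‖u (q (i + 1)) - u (q i)‖ₑ ≤ openSlope δ u (q i) * edist (q i) (q (i + 1)) := by
    rw [edist_comm]
    exact (enorm_sub_le_slopeAt_mul u ((dist_comm _ _).trans_le hd)).trans
      (by gcongr; exact slopeAt_le_openSlope h u _)
  have h2 : ‖u (q (i + 1)) - u (q i)‖ₑ ≤ openSlope δ u (q (i + 1)) * edist (q i) (q (i + 1)) := by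
    rw [enorm_sub_rev]
    exact (enorm_sub_le_slopeAt_mul u hd).trans (by gcongr; exact slopeAt_le_openSlope h u _)
  calc ‖u (q (i + 1)) - u (q i)‖ₑ
      = (‖u (q (i + 1)) - u (q i)‖ₑ + ‖u (q (i + 1)) - u (q i)‖ₑ) / 2 := by
        rw [ENNReal.add_div, ENNReal.add_halves]
    _ ≤ (openSlope δ u (q i) * edist (q i) (q (i + 1)) +
          openSlope δ u (q (i + 1)) * edist (q i) (q (i + 1))) / 2 := by gcongr
    _ = _ := by
        rw [← add_mul, div_eq_mul_inv, div_eq_mul_inv]; ring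

end Slope

/-! ### Arc length and arc-length integrals -/

section Curves

variable {X : Type*} [MetricSpace X]

theorem IsRectifiableCurve.locallyBoundedVariationOn {γ : ℝ → X} {a b : ℝ}
    (h : IsRectifiableCurve γ a b) : LocallyBoundedVariationOn γ (Set.Icc a b) :=
  BoundedVariationOn.locallyBoundedVariationOn h.2.2.ne

/-- The arc length of a rectifiable curve is a continuous function of the parameter. -/
theorem IsRectifiableCurve.continuousOn_variationOnFromTo {γ : ℝ → X} {a b : ℝ}
    (h : IsRectifiableCurve γ a b) :
    ContinuousOn (variationOnFromTo γ (Set.Icc a b) a) (Set.Icc a b) := by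
  have hl := h.locallyBoundedVariationOn
  have hb : BoundedVariationOn γ (Set.Icc a b) := h.2.2.ne
  have ha : a ∈ Set.Icc a b := ⟨le_rfl, h.1.le⟩
  intro x hx
  have hr := (ENNReal.tendsto_toReal ENNReal.zero_ne_top).comp
    (hb.tendsto_eVariationOn_Icc_zero_right x ((h.2.1 x hx).mono Set.inter_subset_left))
  have hle := (ENNReal.tendsto_toReal ENNReal.zero_ne_top).comp
    (hb.tendsto_eVariationOn_Icc_zero_left (x := x) ((h.2.1 x hx).mono Set.inter_subset_left))
  have h0 := hr.sub hle
  simp only [ENNReal.toReal_zero, sub_zero] at h0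
  have h1 := h0.const_add (variationOnFromTo γ (Set.Icc a b) a x)
  rw [add_zero] at h1
  refine Tendsto.congr' ?_ h1
  filter_upwards [self_mem_nhdsWithin] with y hy
  rw [← variationOnFromTo.add hl ha hx hy]
  congr 1
  rcases le_total x y with hxy | hxy
  · rw [variationOnFromTo.eq_of_le _ _ hxy]
    simp only [Function.comp_apply]
    rw [eVariationOn.subsingleton γ (s := Set.Icc a b ∩ Set.Icc y x), ENNReal.toReal_zero, sub_zero]
    rintro z ⟨-, hz⟩ w ⟨-, hw⟩
    exact le_antisymm (hz.2.trans (hxy.trans hw.1)) (hw.2.trans (hxy.trans hz.1))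
  · rw [variationOnFromTo.eq_of_ge _ _ hxy]
    simp only [Function.comp_apply]
    rw [eVariationOn.subsingleton γ (s := Set.Icc a b ∩ Set.Icc x y), ENNReal.toReal_zero, zero_sub]
    rintro z ⟨-, hz⟩ w ⟨-, hw⟩
    exact le_antisymm (hz.2.trans (hxy.trans hw.1)) (hw.2.trans (hxy.trans hz.1))

theorem IsRectifiableCurve.variationOnFromTo_right {γ : ℝ → X} {a b : ℝ}
    (h : IsRectifiableCurve γ a b) :
    variationOnFromTo γ (Set.Icc a b) a b = (eVariationOn γ (Set.Icc a b)).toReal := by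
  rw [variationOnFromTo.eq_of_le _ _ h.1.le, Set.inter_self]

theorem IsRectifiableCurve.image_variationOnFromTo {γ : ℝ → X} {a b : ℝ}
    (h : IsRectifiableCurve γ a b) :
    variationOnFromTo γ (Set.Icc a b) a '' Set.Icc a b =
      Set.Icc 0 (eVariationOn γ (Set.Icc a b)).toReal := by
  have ha : a ∈ Set.Icc a b := ⟨le_rfl, h.1.le⟩
  have hb : b ∈ Set.Icc a b := ⟨h.1.le, le_rfl⟩
  have hm := variationOnFromTo.monotoneOn h.locallyBoundedVariationOn ha
  refine Set.Subset.antisymm ?_ ?_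
  · rintro _ ⟨t, ht, rfl⟩
    refine ⟨variationOnFromTo.nonneg_of_le _ _ ht.1, ?_⟩
    rw [← h.variationOnFromTo_right]
    exact hm ht hb ht.2
  · have := intermediate_value_Icc h.1.le h.continuousOn_variationOnFromTo
    rwa [variationOnFromTo.self, h.variationOnFromTo_right] at this

theorem IsRectifiableCurve.naturalParameterization_variationOnFromTo {γ : ℝ → X} {a b : ℝ}
    (h : IsRectifiableCurve γ a b) {t : ℝ} (ht : t ∈ Set.Icc a b) :
    naturalParameterization γ (Set.Icc a b) a (variationOnFromTo γ (Set.Icc a b) a t) = γ t :=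
  edist_eq_zero.1 (edist_naturalParameterization_eq_zero h.locallyBoundedVariationOn
    ⟨le_rfl, h.1.le⟩ ht)

theorem IsRectifiableCurve.naturalParameterization_left {γ : ℝ → X} {a b : ℝ}
    (h : IsRectifiableCurve γ a b) : naturalParameterization γ (Set.Icc a b) a 0 = γ a := by
  rw [← h.naturalParameterization_variationOnFromTo ⟨le_rfl, h.1.le⟩, variationOnFromTo.self]

theorem IsRectifiableCurve.naturalParameterization_right {γ : ℝ → X} {a b : ℝ}
    (h : IsRectifiableCurve γ a b) :
    naturalParameterization γ (Set.Icc a b) a (eVariationOn γ (Set.Icc a b)).toReal = γ b := by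
  rw [← h.variationOnFromTo_right]
  exact h.naturalParameterization_variationOnFromTo ⟨h.1.le, le_rfl⟩

theorem IsRectifiableCurve.lipschitzOnWith_naturalParameterization {γ : ℝ → X} {a b : ℝ}
    (h : IsRectifiableCurve γ a b) :
    LipschitzOnWith 1 (naturalParameterization γ (Set.Icc a b) a)
      (Set.Icc 0 (eVariationOn γ (Set.Icc a b)).toReal) := by
  have hu := has_unit_speed_naturalParameterization γ h.locallyBoundedVariationOn
    (a := a) ⟨le_rfl, h.1.le⟩
  rw [h.image_variationOnFromTo] at hu
  have key : ∀ ⦃s⦄, s ∈ Set.Icc 0 (eVariationOn γ (Set.Icc a b)).toReal → ∀ ⦃t⦄,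
      t ∈ Set.Icc 0 (eVariationOn γ (Set.Icc a b)).toReal → s ≤ t →
      edist (naturalParameterization γ (Set.Icc a b) a s)
        (naturalParameterization γ (Set.Icc a b) a t) ≤ edist s t := by
    intro s hs t ht hst
    refine (eVariationOn.edist_le _ (s := Set.Icc 0 (eVariationOn γ (Set.Icc a b)).toReal ∩
      Set.Icc s t) ⟨hs, le_rfl, hst⟩ ⟨ht, hst, le_rfl⟩).trans ?_
    rw [hu hs ht, edist_comm, edist_dist, Real.dist_eq, abs_of_nonneg (sub_nonneg.2 hst)]
    simp
  intro s hs t ht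
  rw [ENNReal.coe_one, one_mul]
  rcases le_total s t with hst | hst
  · exact key hs ht hst
  · rw [edist_comm, edist_comm s]
    exact key ht hs hst

theorem isRectifiableCurve_of_lipschitzOnWith {γ : ℝ → X} {C : ℝ≥0} {a b : ℝ} (hab : a < b)
    (hγ : LipschitzOnWith C γ (Set.Icc a b)) : IsRectifiableCurve γ a b := by
  refine ⟨hab, hγ.continuousOn, ?_⟩
  have h1 := hγ.comp_eVariationOn_le (Set.mapsTo_id (Set.Icc a b))
  have h2 := (monotone_id.monotoneOn (Set.Icc a b)).eVariationOn_eq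
    (⟨le_rfl, hab.le⟩ : a ∈ Set.Icc a b) ⟨hab.le, le_rfl⟩
  rw [Set.inter_self] at h2
  exact h1.trans_lt (ENNReal.mul_lt_top ENNReal.coe_lt_top (h2.le.trans_lt ENNReal.ofReal_lt_top))

/-- Along a Lipschitz parametrization the arc length is Lipschitz with the same constant. -/
theorem lipschitzOnWith_variationOnFromTo {γ : ℝ → X} {C : ℝ≥0} {a b : ℝ} (hab : a < b)
    (hγ : LipschitzOnWith C γ (Set.Icc a b)) :
    LipschitzOnWith C (variationOnFromTo γ (Set.Icc a b) a) (Set.Icc a b) := by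
  have hr := isRectifiableCurve_of_lipschitzOnWith hab hγ
  have ha : a ∈ Set.Icc a b := ⟨le_rfl, hab.le⟩
  refine LipschitzOnWith.of_le_add_mul C fun x hx y hy => ?_
  rcases le_total y x with hxy | hxy
  · rw [← variationOnFromTo.add hr.locallyBoundedVariationOn ha hy hx,
      variationOnFromTo.eq_of_le _ _ hxy]
    gcongr
    have h1 := (hγ.mono (Set.inter_subset_left (t := Set.Icc y x))).comp_eVariationOn_le
      (Set.mapsTo_id _)
    have h2 := (monotone_id.monotoneOn (Set.Icc a b)).eVariationOn_eq hy hx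
    refine ENNReal.toReal_le_of_le_ofReal (by positivity) (h1.trans ?_)
    rw [ENNReal.ofReal_mul C.coe_nonneg, Real.dist_eq, abs_of_nonneg (sub_nonneg.2 hxy),
      ENNReal.ofReal_coe_nnreal, h2]
    rfl
  · have := variationOnFromTo.monotoneOn hr.locallyBoundedVariationOn ha hx hy hxy
    have : 0 ≤ C * dist x y := by positivity
    linarith

/-- The arc-length integral along a curve is at most the integral against the Lipschitz constant of
any Lipschitz parametrization. -/
theorem curveLIntegral_le_of_lipschitzOnWith {γ : ℝ → X} {C : ℝ≥0} {a b : ℝ} (hab : a < b)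
    (hγ : LipschitzOnWith C γ (Set.Icc a b)) (g : X → ℝ≥0∞) :
    curveLIntegral g γ a b ≤ C * ∫⁻ t in Set.Icc a b, g (γ t) := by
  have hr := isRectifiableCurve_of_lipschitzOnWith hab hγ
  set V := variationOnFromTo γ (Set.Icc a b) a with hV
  have hVl : LipschitzOnWith C V (Set.Icc a b) := lipschitzOnWith_variationOnFromTo hab hγ
  have hVm : AEMeasurable V (volume.restrict (Set.Icc a b)) :=
    hVl.continuousOn.aemeasurable measurableSet_Icc
  -- the arc length does not increase measures by more than the factor `C`
  have hle : volume.restrict (Set.Icc 0 (eVariationOn γ (Set.Icc a b)).toReal) ≤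
      (C : ℝ≥0∞) • Measure.map V (volume.restrict (Set.Icc a b)) := by
    refine Measure.le_iff.2 fun A hA => ?_
    rw [Measure.restrict_apply hA, Measure.smul_apply, smul_eq_mul,
      Measure.map_apply_of_aemeasurable hVm hA]
    have hsub : A ∩ Set.Icc 0 (eVariationOn γ (Set.Icc a b)).toReal ⊆
        V '' (V ⁻¹' A ∩ Set.Icc a b) := by
      rintro s ⟨hsA, hs⟩
      rw [← hr.image_variationOnFromTo] at hs
      obtain ⟨t, ht, rfl⟩ := hs
      exact ⟨t, ⟨hsA, ht⟩, rfl⟩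
    have himg := (hVl.mono (Set.inter_subset_right (s := V ⁻¹' A))).hausdorffMeasure_image_le
      zero_le_one
    rw [hausdorffMeasure_real, ENNReal.rpow_one] at himg
    refine (measure_mono hsub).trans (himg.trans ?_)
    exact mul_le_mul_right (Measure.le_restrict_apply _ _) _
  calc curveLIntegral g γ a b
      ≤ ∫⁻ s, g (naturalParameterization γ (Set.Icc a b) a s)
          ∂((C : ℝ≥0∞) • Measure.map V (volume.restrict (Set.Icc a b))) :=
        lintegral_mono' hle le_rfl
    _ = C * ∫⁻ s, g (naturalParameterization γ (Set.Icc a b) a s)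
          ∂(Measure.map V (volume.restrict (Set.Icc a b))) := by
        rw [lintegral_smul_measure, smul_eq_mul]
    _ ≤ C * ∫⁻ t in Set.Icc a b, g (naturalParameterization γ (Set.Icc a b) a (V t)) := by
        exact mul_le_mul_right (lintegral_map_le _ _) _
    _ = C * ∫⁻ t in Set.Icc a b, g (γ t) := by
        congr 1
        refine setLIntegral_congr_fun measurableSet_Icc fun t ht => ?_
        exact congrArg g (hr.naturalParameterization_variationOnFromTo ht)

end Curves

/-! ### From chains to curves -/

section Averaging

theorem lintegral_sum_translates (G : ℝ → ℝ≥0∞) (hG : Measurable G) {h : ℝ} (hh : 0 ≤ h) (n : ℕ) :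
    ∫⁻ s in Set.Ioc 0 h, ∑ k ∈ Finset.range n, G (s + k * h) = ∫⁻ t in Set.Ioc 0 (n * h), G t := by
  rw [lintegral_finsetSum (f := fun (k : ℕ) s => G (s + k * h)) _
    fun k _ => hG.comp (measurable_add_const _)]
  induction n with
  | zero => simp
  | succ n ih =>
    have hn : (0 : ℝ) ≤ n * h := by positivity
    have hn' : n * h ≤ ((n + 1 : ℕ) : ℝ) * h := by push_cast; linarith
    rw [Finset.sum_range_succ, ih, ← Set.Ioc_union_Ioc_eq_Ioc hn hn',
      lintegral_union measurableSet_Ioc (Set.Ioc_disjoint_Ioc_of_le le_rfl)]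
    congr 1
    have := (measurePreserving_add_right volume ((n : ℝ) * h)).setLIntegral_comp_preimage
      (measurableSet_Ioc (a := (n : ℝ) * h) (b := ((n + 1 : ℕ) : ℝ) * h)) hG
    rw [← this]
    congr 3
    ext s
    simp only [Set.mem_Ioc, Set.mem_preimage]
    push_cast
    constructor <;> rintro ⟨h1, h2⟩ <;> constructor <;> linarith

variable {X : Type*} [MetricSpace X] [MeasurableSpace X] [BorelSpace X]

/-- A chain upper gradient satisfies the upper gradient inequality along every `1`-Lipschitz curve
whose end points are not poles: the Riemann sums of the chains with equidistant times average to the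
integral when the times are shifted. -/
theorem IsChainUpperGradient.enorm_sub_le_lintegral_of_lipschitzWith {ε : ℝ} (hε : 0 < ε)
    {u : X → ℝ} {g : X → ℝ≥0∞} (hg : IsChainUpperGradient ε u g) {Γ : ℝ → X}
    (hΓ : LipschitzWith 1 Γ) {l : ℝ} (hl : 0 ≤ l) (h0 : g (Γ 0) < ∞) (h1 : g (Γ l) < ∞) :
    ‖u (Γ l) - u (Γ 0)‖ₑ ≤ ∫⁻ t in Set.Icc 0 l, g (Γ t) := by
  rcases hl.eq_or_lt with rfl | hl
  · simp
  set I := ∫⁻ t in Set.Icc 0 l, g (Γ t) with hI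
  set c := (g (Γ 0) + g (Γ l)) / 2 with hc
  have hctop : c ≠ ∞ := (ENNReal.div_lt_top (ENNReal.add_lt_top.2 ⟨h0, h1⟩).ne two_ne_zero).ne
  have hGm : Measurable fun t => g (Γ t) := hg.1.comp hΓ.continuous.measurable
  have main : ∀ᶠ n : ℕ in atTop, ‖u (Γ l) - u (Γ 0)‖ₑ ≤ I + ENNReal.ofReal (l / n) * c := by
    have hlim : Tendsto (fun n : ℕ => l / n) atTop (𝓝 0) := tendsto_const_div_atTop_nhds_zero_nat l
    filter_upwards [hlim.eventually_le_const hε, eventually_gt_atTop 0] with n hn hn0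
    set h := l / n with hh
    have hn0' : (0 : ℝ) < n := Nat.cast_pos.2 hn0
    have hhpos : 0 < h := div_pos hl hn0'
    have hnh : n * h = l := by rw [hh]; field_simp
    have hmeas : Measurable fun s => ∑ k ∈ Finset.range n, g (Γ (s + k * h)) :=
      Finset.measurable_fun_sum _ fun k _ => hGm.comp (measurable_id.add_const _)
    obtain ⟨s, hs, hsle⟩ := exists_le_setLAverage (μ := volume) (s := Set.Ioc 0 h)
      (f := fun s => ∑ k ∈ Finset.range n, g (Γ (s + k * h)))
      (by simp [hhpos]) (by simp) hmeas.aemeasurable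
    rw [setLAverage_eq, lintegral_sum_translates _ hGm hhpos.le, hnh, Real.volume_Ioc, sub_zero]
      at hsle
    set S := ∑ k ∈ Finset.range n, g (Γ (s + k * h)) with hS
    have hSI : ENNReal.ofReal h * S ≤ I := by
      have h2 : ENNReal.ofReal h * S ≤ ∫⁻ t in Set.Ioc 0 l, g (Γ t) := by
        rw [mul_comm]
        exact (ENNReal.le_div_iff_mul_le (Or.inl (by simpa using hhpos))
          (Or.inl ENNReal.ofReal_ne_top)).1 hsle
      exact h2.trans (lintegral_mono_set Set.Ioc_subset_Icc_self)
    -- the times of the chain: `0, s, s + h, …, s + (n - 1) h, l`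
    set τ : ℕ → ℝ := fun i => if i = 0 then 0 else if i ≤ n then s + ((i : ℝ) - 1) * h else l
      with hτ
    have τ0 : τ 0 = 0 := by simp [hτ]
    have τs : ∀ k < n, τ (k + 1) = s + k * h := by
      intro k hk
      have : k + 1 ≤ n := hk
      simp [hτ, this]
    have τl : τ (n + 1) = l := by simp [hτ]
    have hstep : ∀ i < n + 1, dist (τ i) (τ (i + 1)) ≤ h := by
      intro i hi
      rw [dist_comm, Real.dist_eq, abs_le]
      obtain ⟨hs1, hs2⟩ := hs
      rcases Nat.eq_zero_or_pos i with rfl | hi0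
      · have := τs 0 hn0
        rw [zero_add] at this ⊢
        rw [this, τ0]
        constructor <;> simp <;> linarith
      · obtain ⟨k, rfl⟩ : ∃ k, i = k + 1 := ⟨i - 1, by omega⟩
        have hk : k < n := by omega
        rw [τs k hk]
        rcases (Nat.succ_le_of_lt hk).eq_or_lt with hkn | hkn
        · have hkn' : k + 1 + 1 = n + 1 := by omega
          have hkr : (n : ℝ) = k + 1 := by rw [← hkn]; push_cast; ring
          have hl' : l = k * h + h := by rw [← hnh, hkr]; ring
          rw [hkn', τl, hl']
          constructor <;> linarith
        · rw [τs (k + 1) hkn]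
          push_cast
          constructor <;> linarith
    have hchain := hg.2 (n + 1) (Γ ∘ τ) fun i hi =>
      ((hΓ.dist_le_mul _ _).trans (by simpa using hstep i hi)).trans hn
    simp only [Function.comp_apply, τ0, τl] at hchain
    refine hchain.trans ?_
    have hsum : chainIntegral g (n + 1) (Γ ∘ τ) ≤ ∑ i ∈ Finset.range (n + 1),
        (g (Γ (τ i)) + g (Γ (τ (i + 1)))) / 2 * ENNReal.ofReal h := by
      refine Finset.sum_le_sum fun i hi => ?_
      simp only [Function.comp_apply]
      gcongr
      rw [edist_dist]
      refine ENNReal.ofReal_le_ofReal (le_trans (hΓ.dist_le_mul _ _) ?_)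
      simpa using hstep i (Finset.mem_range.1 hi)
    refine hsum.trans ?_
    have e1 : ∑ i ∈ Finset.range (n + 1), g (Γ (τ i)) = S + g (Γ 0) := by
      rw [Finset.sum_range_succ', τ0, hS]
      congr 1
      exact Finset.sum_congr rfl fun k hk => by rw [τs k (Finset.mem_range.1 hk)]
    have e2 : ∑ i ∈ Finset.range (n + 1), g (Γ (τ (i + 1))) = S + g (Γ l) := by
      rw [Finset.sum_range_succ, τl, hS]
      congr 1
      exact Finset.sum_congr rfl fun k hk => by rw [τs k (Finset.mem_range.1 hk)]
    rw [← Finset.sum_mul]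
    simp_rw [div_eq_mul_inv]
    rw [← Finset.sum_mul, Finset.sum_add_distrib, e1, e2,
      show S + g (Γ 0) + (S + g (Γ l)) = (S + S) + (g (Γ 0) + g (Γ l)) by ring, add_mul,
      ← div_eq_mul_inv, ← div_eq_mul_inv, ENNReal.add_div, ENNReal.add_halves, add_mul,
      mul_comm S, mul_comm _ (ENNReal.ofReal h)]
    gcongr
  have hlim : Tendsto (fun n : ℕ => I + ENNReal.ofReal (l / n) * c) atTop (𝓝 I) := by
    have h2 := ENNReal.tendsto_ofReal (tendsto_const_div_atTop_nhds_zero_nat l)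
    have h3 := (ENNReal.Tendsto.mul_const h2 (Or.inr hctop)).const_add I
    simpa using h3
  exact ge_of_tendsto hlim main

/-- The same inequality along the arc-length parametrization of a rectifiable curve. -/
theorem IsChainUpperGradient.enorm_sub_le_curveLIntegral {ε : ℝ} (hε : 0 < ε)
    {u : X → ℝ} {g : X → ℝ≥0∞} (hg : IsChainUpperGradient ε u g) {γ : ℝ → X} {a b : ℝ}
    (hγ : IsRectifiableCurve γ a b) (h0 : g (γ a) < ∞) (h1 : g (γ b) < ∞) :
    ‖u (γ b) - u (γ a)‖ₑ ≤ curveLIntegral g γ a b := by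
  set l := (eVariationOn γ (Set.Icc a b)).toReal with hl
  set ν := naturalParameterization γ (Set.Icc a b) a with hν
  have hl0 : (0 : ℝ) ≤ l := ENNReal.toReal_nonneg
  have hL : LipschitzOnWith 1 ν (Set.Icc 0 l) := hγ.lipschitzOnWith_naturalParameterization
  have hext : ∀ t ∈ Set.Icc 0 l, Set.IccExtend hl0 ((Set.Icc 0 l).domRestrict ν) t = ν t :=
    fun t ht => Set.IccExtend_of_mem hl0 _ ht
  have hLip : LipschitzWith 1 (Set.IccExtend hl0 ((Set.Icc 0 l).domRestrict ν)) := by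
    have := hL.to_restrict.comp (LipschitzWith.projIcc hl0)
    rwa [one_mul] at this
  have e0 : Set.IccExtend hl0 ((Set.Icc 0 l).domRestrict ν) 0 = γ a := by
    rw [hext 0 ⟨le_rfl, hl0⟩]; exact hγ.naturalParameterization_left
  have e1 : Set.IccExtend hl0 ((Set.Icc 0 l).domRestrict ν) l = γ b := by
    rw [hext l ⟨hl0, le_rfl⟩]; exact hγ.naturalParameterization_right
  have key := hg.enorm_sub_le_lintegral_of_lipschitzWith hε hLip hl0 (by rwa [e0]) (by rwa [e1])
  rw [e0, e1] at key
  refine key.trans_eq (setLIntegral_congr_fun measurableSet_Icc fun t ht => ?_)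
  exact congrArg g (hext t ht)

/-- The local Lipschitz constant of a Lipschitz function is an upper gradient. -/
theorem isUpperGradient_lip {u : X → ℝ} {K : ℝ≥0} (hu : LipschitzWith K u) :
    IsUpperGradient u (lip u) := by
  refine ⟨measurable_lip hu.continuous, fun γ a b hγ => ?_⟩
  have hbd : ∀ δ x, openSlope δ u x ≤ K := fun δ x =>
    (openSlope_le_slopeAt δ u x).trans (slopeAt_le_of_lipschitzWith hu δ x)
  have hmeas : ∀ n : ℕ, AEMeasurable
      (fun t => openSlope (1 / ((n : ℝ) + 1)) u (naturalParameterization γ (Set.Icc a b) a t))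
      (volume.restrict (Set.Icc 0 (eVariationOn γ (Set.Icc a b)).toReal)) := fun n =>
    (measurable_openSlope _ hu.continuous).comp_aemeasurable
      (hγ.lipschitzOnWith_naturalParameterization.continuousOn.aemeasurable measurableSet_Icc)
  simp only [curveLIntegral, lip_eq_iInf_openSlope]
  rw [lintegral_iInf' hmeas (Eventually.of_forall fun t _ _ h => antitone_openSlope u h _) ?_]
  · refine le_iInf fun n => ?_
    have hpos : (0 : ℝ) < 1 / ((n : ℝ) + 1) := by positivity
    exact (isChainUpperGradient_openSlope (half_lt_self hpos)
      hu.continuous).enorm_sub_le_curveLIntegral (half_pos hpos) hγ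
      ((hbd _ _).trans_lt ENNReal.coe_lt_top) ((hbd _ _).trans_lt ENNReal.coe_lt_top)
  · refine ((lintegral_mono fun t => hbd _ _).trans_lt ?_).ne
    rw [setLIntegral_const]
    exact ENNReal.mul_lt_top ENNReal.coe_lt_top (by simp)

theorem curveEnergy_le_agsEnergy (p : ℝ≥0∞) (μ : Measure X) (u : X → ℝ) :
    curveEnergy p μ u ≤ agsEnergy p μ u := by
  unfold agsEnergy
  split_ifs with h
  · obtain ⟨K, hK⟩ := h
    exact iInf₂_le (lip u) (isUpperGradient_lip hK)
  · exact le_top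

/-- `g` satisfies the upper gradient inequality for `u` along the rectifiable curves whose end
points are not poles of `g`. Upper gradients along curves have this property, and so do upper
gradients along chains, which in general are not upper gradients along curves. -/
def IsUpperGradientOffPoles (u : X → ℝ) (g : X → ℝ≥0∞) : Prop :=
  Measurable g ∧ ∀ (γ : ℝ → X) (a b : ℝ), IsRectifiableCurve γ a b → g (γ a) < ∞ → g (γ b) < ∞ →
    ‖u (γ b) - u (γ a)‖ₑ ≤ curveLIntegral g γ a b

omit [BorelSpace X] in
theorem IsUpperGradient.isUpperGradientOffPoles {u : X → ℝ} {g : X → ℝ≥0∞}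
    (h : IsUpperGradient u g) : IsUpperGradientOffPoles u g :=
  ⟨h.1, fun γ a b hγ _ _ => h.2 γ a b hγ⟩

theorem IsChainUpperGradient.isUpperGradientOffPoles {ε : ℝ} (hε : 0 < ε) {u : X → ℝ}
    {g : X → ℝ≥0∞} (h : IsChainUpperGradient ε u g) : IsUpperGradientOffPoles u g :=
  ⟨h.1, fun _ _ _ hγ h0 h1 => h.enorm_sub_le_curveLIntegral hε hγ h0 h1⟩

end Averaging

/-! ### Lipschitz truncations of lower semicontinuous functions -/

section LipschitzTruncation

variable {X : Type*} [MetricSpace X]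

/-- The `n`-Lipschitz truncation of `g`: the largest `n`-Lipschitz function below `min g n`. For
lower semicontinuous `g` these functions increase to `g`. -/
def lipTrunc (g : X → ℝ≥0∞) (n : ℕ) (x : X) : ℝ≥0∞ :=
  ⨅ y, (min (g y) n + n * edist x y)

theorem lipTrunc_le (g : X → ℝ≥0∞) (n : ℕ) (x : X) : lipTrunc g n x ≤ g x := by
  refine (iInf_le _ x).trans ?_
  simp

theorem lipTrunc_le_natCast (g : X → ℝ≥0∞) (n : ℕ) (x : X) : lipTrunc g n x ≤ n := by
  refine (iInf_le _ x).trans ?_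
  simp

theorem lipTrunc_ne_top (g : X → ℝ≥0∞) (n : ℕ) (x : X) : lipTrunc g n x ≠ ∞ :=
  ne_top_of_le_ne_top (ENNReal.natCast_ne_top n) (lipTrunc_le_natCast g n x)

theorem lipTrunc_le_add (g : X → ℝ≥0∞) (n : ℕ) (x y : X) :
    lipTrunc g n x ≤ lipTrunc g n y + n * edist x y := by
  rw [lipTrunc, lipTrunc, ENNReal.iInf_add]
  refine le_iInf fun z => (iInf_le _ z).trans ?_
  rw [add_assoc, ← mul_add, add_comm (edist y z)]
  gcongr
  exact edist_triangle _ _ _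

theorem monotone_lipTrunc (g : X → ℝ≥0∞) : Monotone (lipTrunc g) := by
  intro m n h x
  refine le_iInf fun z => (iInf_le _ z).trans ?_
  have : (m : ℝ≥0∞) ≤ n := by exact_mod_cast h
  gcongr

theorem le_lipTrunc {g : X → ℝ≥0∞} {n : ℕ} {x : X} {c r : ℝ≥0∞}
    (hg : ∀ y, edist x y < r → c ≤ g y) (hn : c ≤ n) (hr : c ≤ n * r) : c ≤ lipTrunc g n x := by
  refine le_iInf fun y => ?_
  rcases lt_or_ge (edist x y) r with h | h
  · exact (le_min (hg y h) hn).trans le_self_add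
  · exact (hr.trans (by gcongr)).trans le_add_self

theorem iSup_lipTrunc {g : X → ℝ≥0∞} (hg : LowerSemicontinuous g) (x : X) :
    ⨆ n, lipTrunc g n x = g x := by
  refine le_antisymm (iSup_le fun n => lipTrunc_le g n x) (le_of_forall_lt fun c hc => ?_)
  obtain ⟨c', hcc', hc'⟩ := exists_between hc
  obtain ⟨r, hr, hball⟩ := Metric.nhds_basis_eball.eventually_iff.1 (hg x c' hc')
  obtain ⟨m, hm⟩ := ENNReal.exists_nat_gt hc'.ne_top
  obtain ⟨k, hk⟩ := ENNReal.exists_nat_mul_gt hr.ne' hc'.ne_top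
  refine hcc'.trans_le (le_iSup_of_le (max m k) (le_lipTrunc (r := r) ?_ ?_ ?_))
  · intro y hy
    exact (hball (by simpa [edist_comm] using hy)).le
  · exact hm.le.trans (by exact_mod_cast le_max_left m k)
  · refine hk.le.trans ?_
    gcongr
    exact le_max_right m k

theorem abs_toReal_lipTrunc_sub_le (g : X → ℝ≥0∞) (n : ℕ) (x y : X) :
    |(lipTrunc g n x).toReal - (lipTrunc g n y).toReal| ≤ n * dist x y := by
  have key : ∀ x y, (lipTrunc g n x).toReal ≤ (lipTrunc g n y).toReal + n * dist x y := by
    intro x y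
    have h := ENNReal.toReal_mono (ENNReal.add_ne_top.2 ⟨lipTrunc_ne_top g n y,
      ENNReal.mul_ne_top (ENNReal.natCast_ne_top n) (edist_ne_top x y)⟩) (lipTrunc_le_add g n x y)
    rwa [ENNReal.toReal_add (lipTrunc_ne_top g n y)
      (ENNReal.mul_ne_top (ENNReal.natCast_ne_top n) (edist_ne_top x y)), ENNReal.toReal_mul,
      ENNReal.toReal_natCast, ← dist_edist] at h
  rw [abs_le]
  have h1 := key x y
  have h2 := key y x
  rw [dist_comm] at h2
  constructor <;> linarith

theorem toReal_lipTrunc_le_natCast (g : X → ℝ≥0∞) (n : ℕ) (x : X) :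
    (lipTrunc g n x).toReal ≤ n := by
  simpa using ENNReal.toReal_mono (ENNReal.natCast_ne_top n) (lipTrunc_le_natCast g n x)

theorem continuous_toReal_lipTrunc (g : X → ℝ≥0∞) (n : ℕ) :
    Continuous fun x => (lipTrunc g n x).toReal :=
  (LipschitzWith.of_dist_le_mul (K := n) fun x y => by
    simpa [Real.dist_eq] using abs_toReal_lipTrunc_sub_le g n x y).continuous

end LipschitzTruncation

/-! ### Compact sets and lower semicontinuous majorants -/

section Regularity

variable {X : Type*} [MetricSpace X] [CompleteSpace X] [TopologicalSpace.SeparableSpace X]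
  [MeasurableSpace X] [BorelSpace X]

/-- **Lusin's theorem**: an almost everywhere measurable function is continuous on a compact subset
of a given set of full measure, up to small measure. -/
theorem exists_isCompact_continuousOn (ν : Measure X) [IsFiniteMeasure ν] {u : X → ℝ}
    (hu : AEMeasurable u ν) {A : Set X} (hA : ∀ᵐ x ∂ν, x ∈ A) {ε : ℝ≥0∞} (hε : ε ≠ 0) :
    ∃ K ⊆ A, IsCompact K ∧ ContinuousOn u K ∧ ν Kᶜ ≤ ε := by
  have : PolishSpace X := inferInstance
  set S : Set X := {x | x ∈ A ∧ u x = hu.mk u x} with hS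
  have hSae : ν Sᶜ = 0 := by
    have : ∀ᵐ x ∂ν, x ∈ S := by
      filter_upwards [hA, hu.ae_eq_mk] with x h1 h2 using ⟨h1, h2⟩
    exact this
  set B : Set X := (toMeasurable ν Sᶜ)ᶜ with hB
  have hBS : B ⊆ S := Set.compl_subset_comm.1 (subset_toMeasurable ν Sᶜ)
  have hBm : MeasurableSet B := (measurableSet_toMeasurable _ _).compl
  have hB0 : ν Bᶜ = 0 := by rw [hB, compl_compl, measure_toMeasurable, hSae]
  obtain ⟨δ, hδ, hδε⟩ := ENNReal.exists_pos_sum_of_countable' hε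
    (TopologicalSpace.countableBasis ℝ)
  have hδ2 : ∀ U, δ U / 2 ≠ 0 := fun U => (ENNReal.half_pos (hδ U).ne').ne'
  have hVm : ∀ U : TopologicalSpace.countableBasis ℝ, MeasurableSet (hu.mk u ⁻¹' (U : Set ℝ)) :=
    fun U => hu.measurable_mk (TopologicalSpace.isOpen_of_mem_countableBasis U.2).measurableSet
  choose F hFB hFc hFν using fun U : TopologicalSpace.countableBasis ℝ =>
    (hBm.inter (hVm U)).exists_isCompact_sdiff_lt (measure_ne_top ν _) (hδ2 U)
  choose F' hFB' hFc' hFν' using fun U : TopologicalSpace.countableBasis ℝ =>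
    (hBm.diff (hVm U)).exists_isCompact_sdiff_lt (measure_ne_top ν _) (hδ2 U)
  have hFF : ∀ U, F U ∪ F' U ⊆ B := fun U =>
    Set.union_subset ((hFB U).trans Set.inter_subset_left) ((hFB' U).trans Set.sdiff_subset)
  have hne : Nonempty (TopologicalSpace.countableBasis ℝ) := by
    obtain ⟨U, hU, -⟩ := (TopologicalSpace.isBasis_countableBasis ℝ).exists_subset_of_mem_open
      (Set.mem_univ (0 : ℝ)) isOpen_univ
    exact ⟨⟨U, hU⟩⟩
  obtain ⟨U₀⟩ := hne
  refine ⟨⋂ U, (F U ∪ F' U), ?_, ?_, ?_, ?_⟩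
  · exact ((Set.iInter_subset _ U₀).trans (hFF U₀)).trans fun x hx => (hBS hx).1
  · refine ((hFc U₀).union (hFc' U₀)).of_isClosed_subset
      (isClosed_iInter fun U => ((hFc U).union (hFc' U)).isClosed) (Set.iInter_subset _ U₀)
  · rw [continuousOn_iff_continuous_domRestrict,
      (TopologicalSpace.isBasis_countableBasis ℝ).continuous_iff]
    intro U hU
    -- on the compact set the preimage of `U` is the complement of a closed set
    refine ⟨(F' ⟨U, hU⟩)ᶜ, (hFc' ⟨U, hU⟩).isClosed.isOpen_compl, ?_⟩
    ext ⟨x, hx⟩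
    have hxU := Set.mem_iInter.1 hx ⟨U, hU⟩
    have hxS : u x = hu.mk u x := (hBS (hFF _ hxU)).2
    simp only [Set.mem_preimage, Set.mem_compl_iff, Set.domRestrict_apply]
    constructor
    · intro h
      rw [hxS]
      exact (hFB _ (hxU.resolve_right h)).2
    · intro h h'
      rw [hxS] at h
      exact (hFB' _ h').2 h
  · have hsub : (⋂ U, (F U ∪ F' U))ᶜ ⊆ Bᶜ ∪ ⋃ U : TopologicalSpace.countableBasis ℝ,
        ((B ∩ hu.mk u ⁻¹' (U : Set ℝ)) \ F U ∪ (B \ hu.mk u ⁻¹' (U : Set ℝ)) \ F' U) := by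
      intro x hx
      simp only [Set.mem_compl_iff, Set.mem_iInter, not_forall, Set.mem_union, not_or] at hx
      obtain ⟨U, hU1, hU2⟩ := hx
      by_cases hxB : x ∈ B
      · refine Or.inr (Set.mem_iUnion.2 ⟨U, ?_⟩)
        by_cases hxU : x ∈ hu.mk u ⁻¹' (U : Set ℝ)
        · exact Or.inl ⟨⟨hxB, hxU⟩, hU1⟩
        · exact Or.inr ⟨⟨hxB, hxU⟩, hU2⟩
      · exact Or.inl hxB
    refine (measure_mono hsub).trans ((measure_union_le _ _).trans ?_)
    rw [hB0, zero_add]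
    refine (measure_iUnion_le _).trans (le_trans (ENNReal.tsum_le_tsum fun U => ?_) hδε.le)
    refine (measure_union_le _ _).trans ?_
    rw [← ENNReal.add_halves (δ U)]
    exact add_le_add (hFν U).le (hFν' U).le

/-- A `p`-integrable function has a lower semicontinuous majorant of almost the same `p`-energy
which is bounded below by a positive constant and arbitrarily large outside compact sets. -/
theorem exists_lowerSemicontinuous_majorant (ν : Measure X) [IsFiniteMeasure ν] {q : ℝ}
    (hq : 0 < q) {g : X → ℝ≥0∞} (hg : Measurable g) {c : ℝ≥0∞} (hc : ∫⁻ x, g x ^ q ∂ν < c) :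
    ∃ G : X → ℝ≥0∞, LowerSemicontinuous G ∧ (∀ x, g x ≤ G x) ∧ ∫⁻ x, G x ^ q ∂ν ≤ c ∧
      (∃ δ : ℝ≥0, 0 < δ ∧ ∀ x, (δ : ℝ≥0∞) ≤ G x) ∧
      ∃ K : ℕ → Set X, (∀ m, IsCompact (K m)) ∧ ∀ m, ∀ x ∉ K m, (m : ℝ≥0∞) ≤ G x := by
  have : PolishSpace X := inferInstance
  set e := c - ∫⁻ x, g x ^ q ∂ν with he
  have he0 : e ≠ 0 := (tsub_pos_of_lt hc).ne'
  have hsum : ∫⁻ x, g x ^ q ∂ν + e = c := add_tsub_cancel_of_le hc.le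
  have he3 : e / 3 ≠ 0 := (ENNReal.div_pos he0 (by simp)).ne'
  obtain ⟨G₀, hgG₀, hG₀, hG₀int⟩ := exists_le_lowerSemicontinuous_lintegral_ge ν
    (fun x => g x ^ q) (hg.pow_const q) he3
  obtain ⟨δ, hδ, hδe⟩ := ENNReal.exists_pos_sum_of_countable' he3 ℕ
  have hK : ∀ m : ℕ, ∃ K : Set X, IsCompact K ∧ (m : ℝ≥0∞) ^ q * ν Kᶜ ≤ δ m := by
    intro m
    have hmq : (m : ℝ≥0∞) ^ q ≠ ∞ :=
      ENNReal.rpow_ne_top_of_nonneg hq.le (ENNReal.natCast_ne_top m)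
    obtain ⟨K, -, hK, hKν⟩ := (MeasurableSet.univ (α := X)).exists_isCompact_sdiff_lt
      (measure_ne_top ν _) (ε := δ m / (m : ℝ≥0∞) ^ q) (ENNReal.div_pos (hδ m).ne' hmq).ne'
    refine ⟨K, hK, ?_⟩
    rw [← Set.compl_eq_univ_sdiff] at hKν
    exact (mul_le_mul_right hKν.le _).trans ENNReal.mul_div_le
  choose K hKc hKν using hK
  set κ := e / 3 / (ν Set.univ + 1) with hκ
  have hκ0 : 0 < κ := ENNReal.div_pos he3 (by simp [measure_ne_top])
  set G₁ : X → ℝ≥0∞ := fun x => G₀ x + κ +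
    ∑' m : ℕ, (K m)ᶜ.indicator (fun _ => (m : ℝ≥0∞) ^ q) x with hG₁
  have hmeas : ∀ m : ℕ, Measurable ((K m)ᶜ.indicator (fun _ => (m : ℝ≥0∞) ^ q)) := fun m =>
    measurable_const.indicator (hKc m).measurableSet.compl
  have hG₁lsc : LowerSemicontinuous G₁ := by
    refine (hG₀.add lowerSemicontinuous_const).add (lowerSemicontinuous_tsum fun m => ?_)
    exact (hKc m).isClosed.isOpen_compl.lowerSemicontinuous_indicator zero_le
  have hG₁int : ∫⁻ x, G₁ x ∂ν ≤ c := by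
    rw [hG₁, lintegral_add_right _ (Measurable.tsum hmeas),
      lintegral_add_right _ measurable_const, lintegral_tsum fun m => (hmeas m).aemeasurable,
      lintegral_const, ← hsum]
    have h1 : κ * ν Set.univ ≤ e / 3 :=
      (mul_le_mul_right le_self_add _).trans ((mul_comm _ _).trans_le ENNReal.mul_div_le)
    have h2 : ∑' m : ℕ, ∫⁻ x, (K m)ᶜ.indicator (fun _ => (m : ℝ≥0∞) ^ q) x ∂ν ≤ e / 3 := by
      refine le_trans (ENNReal.tsum_le_tsum fun m => ?_) hδe.le
      rw [lintegral_indicator_const (hKc m).measurableSet.compl]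
      exact hKν m
    calc _ ≤ (∫⁻ x, g x ^ q ∂ν + e / 3) + e / 3 + e / 3 := by gcongr
      _ = ∫⁻ x, g x ^ q ∂ν + (e / 3 + e / 3 + e / 3) := by ring
      _ = _ := by rw [ENNReal.add_thirds]
  have hroot : ∀ {a b : ℝ≥0∞}, a ^ q ≤ b → a ≤ b ^ (1 / q) := fun {a b} h => by
    rw [one_div]; exact (ENNReal.le_rpow_inv_iff hq).2 h
  refine ⟨fun x => G₁ x ^ (1 / q), ?_, fun x => hroot ?_, ?_, ?_, K, hKc, fun m x hx => hroot ?_⟩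
  · exact ENNReal.continuous_rpow_const.comp_lowerSemicontinuous hG₁lsc
      (ENNReal.monotone_rpow_of_nonneg (by positivity))
  · exact (hgG₀ x).trans (le_self_add.trans le_self_add)
  · simpa only [← ENNReal.rpow_mul, one_div, inv_mul_cancel₀ hq.ne', ENNReal.rpow_one] using hG₁int
  · have hpos : 0 < κ ^ (1 / q) := by
      rcases eq_or_ne κ ∞ with h | h
      · rw [h, ENNReal.top_rpow_of_pos (by positivity)]; exact ENNReal.zero_lt_top
      · exact ENNReal.rpow_pos hκ0 h
    obtain ⟨d, hd0, hd⟩ := ENNReal.lt_iff_exists_nnreal_btwn.1 hpos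
    refine ⟨d, by exact_mod_cast hd0, fun x => hd.le.trans ?_⟩
    exact ENNReal.rpow_le_rpow (le_add_self.trans le_self_add) (by positivity)
  · refine le_trans ?_ le_add_self
    refine le_trans ?_ (ENNReal.le_tsum m)
    rw [Set.indicator_of_mem (by exact hx)]

end Regularity

/-! ### Discrete value functions -/

section ChainInf

variable {X : Type*} [MetricSpace X]

/-- The real-valued integral of `G` along the chain `q 0, …, q N`. -/
def chainCost (G : X → ℝ) (N : ℕ) (q : ℕ → X) : ℝ :=
  ∑ i ∈ Finset.range N, (G (q i) + G (q (i + 1))) / 2 * dist (q i) (q (i + 1))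

theorem chainCost_nonneg {G : X → ℝ} (hG : ∀ x, 0 ≤ G x) (N : ℕ) (q : ℕ → X) :
    0 ≤ chainCost G N q :=
  Finset.sum_nonneg fun i _ => mul_nonneg (by linarith [hG (q i), hG (q (i + 1))]) dist_nonneg

theorem chainCost_mono {G H : X → ℝ} (h : ∀ x, G x ≤ H x) (N : ℕ) (q : ℕ → X) :
    chainCost G N q ≤ chainCost H N q :=
  Finset.sum_le_sum fun i _ =>
    mul_le_mul_of_nonneg_right (by linarith [h (q i), h (q (i + 1))]) dist_nonneg

/-- The competitors in the definition of `chainInf`: the cap `M`, and the boundary value plus the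
cost of each chain of mesh `r` that leads from `K` to `x`. -/
def chainValues (r : ℝ) (G : X → ℝ) (K : Set X) (u : X → ℝ) (M : ℝ) (x : X) : Set ℝ :=
  {t | t = M ∨ ∃ (N : ℕ) (q : ℕ → X), IsChainOfSize r N q ∧ q 0 ∈ K ∧ q N = x ∧
    t = u (q 0) + chainCost G N q}

/-- The discrete value function with running cost `G` and boundary values `u` on `K`, capped at
`M`. -/
def chainInf (r : ℝ) (G : X → ℝ) (K : Set X) (u : X → ℝ) (M : ℝ) (x : X) : ℝ :=
  sInf (chainValues r G K u M x)

variable {r : ℝ} {G : X → ℝ} {K : Set X} {u : X → ℝ} {M : ℝ}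

theorem neg_mem_lowerBounds_chainValues (hG : ∀ x, 0 ≤ G x) (hu : ∀ x, |u x| ≤ M) (x : X) :
    -M ∈ lowerBounds (chainValues r G K u M x) := by
  rintro t (rfl | ⟨N, q, -, -, -, rfl⟩)
  · linarith [(abs_nonneg _).trans (hu x)]
  · linarith [(abs_le.1 (hu (q 0))).1, chainCost_nonneg hG N q]

theorem bddBelow_chainValues (hG : ∀ x, 0 ≤ G x) (hu : ∀ x, |u x| ≤ M) (x : X) :
    BddBelow (chainValues r G K u M x) := ⟨-M, neg_mem_lowerBounds_chainValues hG hu x⟩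

theorem chainInf_le_cap (hG : ∀ x, 0 ≤ G x) (hu : ∀ x, |u x| ≤ M) (x : X) :
    chainInf r G K u M x ≤ M :=
  csInf_le (bddBelow_chainValues hG hu x) (Or.inl rfl)

theorem abs_chainInf_le (hG : ∀ x, 0 ≤ G x) (hu : ∀ x, |u x| ≤ M) (x : X) :
    |chainInf r G K u M x| ≤ M :=
  abs_le.2 ⟨le_csInf ⟨M, Or.inl rfl⟩ (neg_mem_lowerBounds_chainValues hG hu x),
    chainInf_le_cap hG hu x⟩

theorem chainInf_le_of_mem (hG : ∀ x, 0 ≤ G x) (hu : ∀ x, |u x| ≤ M) {x : X} (hx : x ∈ K) :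
    chainInf r G K u M x ≤ u x :=
  csInf_le (bddBelow_chainValues hG hu x)
    (Or.inr ⟨0, fun _ => x, fun i hi => absurd hi (Nat.not_lt_zero i), hx, rfl,
      by simp [chainCost]⟩)

/-- Dynamic programming: appending one step to a chain. -/
theorem chainInf_le_add (hG : ∀ x, 0 ≤ G x) (hu : ∀ x, |u x| ≤ M) {x y : X} (h : dist x y ≤ r) :
    chainInf r G K u M y ≤ chainInf r G K u M x + (G x + G y) / 2 * dist x y := by
  have hstep : 0 ≤ (G x + G y) / 2 * dist x y :=
    mul_nonneg (by linarith [hG x, hG y]) dist_nonneg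
  rw [← sub_le_iff_le_add]
  refine le_csInf ⟨M, Or.inl rfl⟩ ?_
  rintro t (rfl | ⟨N, q, hq, hq0, hqN, rfl⟩)
  · linarith [chainInf_le_cap (r := r) (K := K) hG hu y]
  rw [sub_le_iff_le_add]
  set q' : ℕ → X := fun i => if i ≤ N then q i else y with hq'
  have hle : ∀ i ≤ N, q' i = q i := fun i hi => if_pos hi
  have hlast : q' (N + 1) = y := if_neg (by omega)
  refine csInf_le (bddBelow_chainValues hG hu y) (Or.inr ⟨N + 1, q', ?_, ?_, hlast, ?_⟩)
  · intro i hi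
    rcases Nat.lt_succ_iff_lt_or_eq.1 hi with hi | rfl
    · rw [hle i hi.le, hle (i + 1) hi]
      exact hq i hi
    · rw [hle i le_rfl, hlast, hqN]
      exact h
  · rwa [hle 0 (Nat.zero_le _)]
  · rw [hle 0 (Nat.zero_le _), chainCost, chainCost, Finset.sum_range_succ, hle N le_rfl, hlast,
      hqN, ← add_assoc]
    congr 2
    refine Finset.sum_congr rfl fun i hi => ?_
    have hi := Finset.mem_range.1 hi
    rw [hle i hi.le, hle (i + 1) hi]

theorem abs_chainInf_sub_le (hG : ∀ x, 0 ≤ G x) (hu : ∀ x, |u x| ≤ M) {x y : X}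
    (h : dist x y ≤ r) :
    |chainInf r G K u M y - chainInf r G K u M x| ≤ (G x + G y) / 2 * dist x y := by
  have h1 := chainInf_le_add (K := K) hG hu h
  have h2 := chainInf_le_add (r := r) (K := K) hG hu (x := y) (y := x) (by rwa [dist_comm])
  rw [dist_comm y x, add_comm (G y)] at h2
  rw [abs_le]
  constructor <;> linarith

theorem exists_lipschitzWith_chainInf (hr : 0 < r) (hG : ∀ x, 0 ≤ G x) (hu : ∀ x, |u x| ≤ M)
    {B : ℝ} (hB : ∀ x, G x ≤ B) : ∃ C, LipschitzWith C (chainInf r G K u M) := by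
  refine ⟨Real.toNNReal (max B (2 * M / r)), LipschitzWith.of_dist_le_mul fun x y => ?_⟩
  refine le_trans ?_ (mul_le_mul_of_nonneg_right (Real.le_coe_toNNReal _) dist_nonneg)
  have hM : 0 ≤ M := (abs_nonneg _).trans (hu x)
  rcases le_or_gt (dist x y) r with h | h
  · rw [dist_comm, Real.dist_eq]
    refine (abs_chainInf_sub_le hG hu h).trans (mul_le_mul_of_nonneg_right ?_ dist_nonneg)
    exact le_max_of_le_left (by linarith [hB x, hB y])
  · -- far apart points: the function oscillates by at most `2 * M`
    have h1 : dist (chainInf r G K u M x) (chainInf r G K u M y) ≤ 2 * M := by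
      rw [Real.dist_eq]
      refine (abs_sub _ _).trans ?_
      linarith [abs_chainInf_le (r := r) (K := K) hG hu x,
        abs_chainInf_le (r := r) (K := K) hG hu y]
    calc _ ≤ 2 * M := h1
      _ = 2 * M / r * r := by field_simp
      _ ≤ max B (2 * M / r) * dist x y :=
        mul_le_mul (le_max_right _ _) h.le hr.le (le_max_of_le_right (by positivity))

/-- The local Lipschitz constant of the value function is at most the running cost. -/
theorem lip_chainInf_le (hr : 0 < r) (hG : ∀ x, 0 ≤ G x) (hu : ∀ x, |u x| ≤ M) {B : ℝ}
    (hB : ∀ x y, |G x - G y| ≤ B * dist x y) (x : X) :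
    lip (chainInf r G K u M) x ≤ ENNReal.ofReal (G x) := by
  have hlim : Tendsto (fun ε : ℝ => ENNReal.ofReal (G x + |B| * ε)) (𝓝[>] 0)
      (𝓝 (ENNReal.ofReal (G x))) := by
    have : Tendsto (fun ε : ℝ => G x + |B| * ε) (𝓝 0) (𝓝 (G x + |B| * 0)) :=
      (continuous_const.add (continuous_const.mul continuous_id)).tendsto 0
    rw [mul_zero, add_zero] at this
    exact ENNReal.tendsto_ofReal (this.mono_left nhdsWithin_le_nhds)
  refine ge_of_tendsto hlim ?_
  filter_upwards [Ioc_mem_nhdsGT hr] with ε hε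
  refine (iInf₂_le ε hε.1).trans (iSup₂_le fun y hy => ENNReal.div_le_of_le_mul ?_)
  have hy : dist x y ≤ ε := by rw [dist_comm]; exact hy
  rw [← ofReal_norm, Real.norm_eq_abs, edist_comm, edist_dist, ← ENNReal.ofReal_mul]
  · refine ENNReal.ofReal_le_ofReal ((abs_chainInf_sub_le hG hu (hy.trans hε.2)).trans ?_)
    refine mul_le_mul_of_nonneg_right ?_ dist_nonneg
    have h1 := (abs_le.1 (hB x y)).1
    have h2 : B * dist x y ≤ |B| * ε :=
      mul_le_mul (le_abs_self B) hy dist_nonneg (abs_nonneg B)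
    have h3 : 0 ≤ |B| * ε := mul_nonneg (abs_nonneg B) hε.1.le
    linarith
  · exact add_nonneg (hG x) (mul_nonneg (abs_nonneg B) hε.1.le)

end ChainInf

/-! ### Length and cost of chains -/

section ChainLength

variable {X : Type*} [MetricSpace X]

/-- The length of the chain `q 0, …, q k`. -/
def chainLength (q : ℕ → X) (k : ℕ) : ℝ :=
  ∑ i ∈ Finset.range k, dist (q i) (q (i + 1))

theorem chainLength_succ (q : ℕ → X) (k : ℕ) :
    chainLength q (k + 1) = chainLength q k + dist (q k) (q (k + 1)) :=
  Finset.sum_range_succ _ _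

theorem monotone_chainLength (q : ℕ → X) : Monotone (chainLength q) :=
  monotone_nat_of_le_succ fun k => by
    rw [chainLength_succ]
    exact le_add_of_nonneg_right dist_nonneg

theorem chainLength_nonneg (q : ℕ → X) (k : ℕ) : 0 ≤ chainLength q k :=
  Finset.sum_nonneg fun _ _ => dist_nonneg

theorem dist_le_abs_chainLength_sub (q : ℕ → X) (j k : ℕ) :
    dist (q j) (q k) ≤ |chainLength q j - chainLength q k| := by
  wlog h : j ≤ k generalizing j k
  · rw [dist_comm, abs_sub_comm]
    exact this k j (le_of_not_ge h)
  refine (dist_le_Ico_sum_dist q h).trans ?_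
  rw [Finset.sum_Ico_eq_sub _ h, abs_sub_comm]
  exact le_abs_self _

/-- Every length between `0` and the length of the chain is attained up to the mesh. -/
theorem exists_abs_chainLength_sub_le {r : ℝ} (hr : 0 ≤ r) {N : ℕ} {q : ℕ → X}
    (hq : IsChainOfSize r N q) {τ : ℝ} (hτ : τ ∈ Set.Icc 0 (chainLength q N)) :
    ∃ k ≤ N, |chainLength q k - τ| ≤ r := by
  induction N with
  | zero =>
    have h0 : chainLength q 0 = 0 := by simp [chainLength]
    rw [h0] at hτ
    exact ⟨0, le_rfl, by rw [h0, le_antisymm hτ.2 hτ.1]; simpa⟩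
  | succ N ih =>
    rcases le_or_gt τ (chainLength q N) with h | h
    · obtain ⟨k, hk, hk'⟩ := ih (fun i hi => hq i (by omega)) ⟨hτ.1, h⟩
      exact ⟨k, by omega, hk'⟩
    · refine ⟨N + 1, le_rfl, ?_⟩
      rw [abs_of_nonneg (sub_nonneg.2 hτ.2), chainLength_succ]
      linarith [hq N (by omega)]

theorem mul_chainLength_le_chainCost {G : X → ℝ} {δ : ℝ} (hG : ∀ x, δ ≤ G x) (N : ℕ)
    (q : ℕ → X) : δ * chainLength q N ≤ chainCost G N q := by
  rw [chainLength, Finset.mul_sum]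
  exact Finset.sum_le_sum fun i _ =>
    mul_le_mul_of_nonneg_right (by linarith [hG (q i), hG (q (i + 1))]) dist_nonneg

/-- If a curve on `[0, 1]` shadows a chain of small mesh, then its weighted integral is at most the
cost of the chain, up to a small error. -/
theorem chainLength_mul_integral_le {r ρ B : ℝ} (hB : 0 ≤ B) {N : ℕ}
    {q : ℕ → X} (hq : IsChainOfSize r N q) {f : X → ℝ} (hf0 : ∀ x, 0 ≤ f x)
    (hf : ∀ x y, |f x - f y| ≤ B * dist x y) {γ : ℝ → X} (hγ : ContinuousOn γ (Set.Icc 0 1))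
    (hγq : ∀ k ≤ N, ∀ t ∈ Set.Icc (0 : ℝ) 1,
      dist (γ t) (q k) ≤ |t * chainLength q N - chainLength q k| + ρ) :
    chainLength q N * ∫ t in (0 : ℝ)..1, f (γ t) ≤
      chainCost f N q + B * (r + ρ) * chainLength q N := by
  rcases (chainLength_nonneg q N).eq_or_lt with h0 | hlen
  · rw [← h0, zero_mul, mul_zero, add_zero]
    exact chainCost_nonneg hf0 N q
  set l := chainLength q N with hl
  set T : ℕ → ℝ := fun k => chainLength q k / l with hT
  have hTm : Monotone T := fun i j h =>
    div_le_div_of_nonneg_right (monotone_chainLength q h) hlen.le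
  have hT0 : T 0 = 0 := by simp [hT, chainLength]
  have hTN : T N = 1 := by simp only [hT]; exact div_self hlen.ne'
  have hfc : Continuous f := (LipschitzWith.of_dist_le_mul (K := ⟨B, hB⟩) fun x y => by
    rw [Real.dist_eq]; exact hf x y).continuous
  have hfγ : ContinuousOn (fun t => f (γ t)) (Set.Icc 0 1) := hfc.comp_continuousOn hγ
  have hT01 : ∀ k ≤ N, T k ∈ Set.Icc (0 : ℝ) 1 := fun k hk =>
    ⟨hT0 ▸ hTm (Nat.zero_le k), hTN ▸ hTm hk⟩
  have hint : ∀ k < N, IntervalIntegrable (fun t => f (γ t)) volume (T k) (T (k + 1)) := by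
    intro k hk
    refine (hfγ.mono ?_).intervalIntegrable
    rw [Set.uIcc_of_le (hTm (Nat.le_succ k))]
    exact Set.Icc_subset_Icc (hT01 k hk.le).1 (hT01 (k + 1) hk).2
  have hsum := intervalIntegral.sum_integral_adjacent_intervals hint
  rw [hT0, hTN] at hsum
  rw [← hsum, Finset.mul_sum, chainCost, hl, chainLength, Finset.mul_sum, ← Finset.sum_add_distrib]
  refine Finset.sum_le_sum fun k hk => ?_
  have hk := Finset.mem_range.1 hk
  set m := (f (q k) + f (q (k + 1))) / 2 + B * (r + ρ) with hm
  have hpt : ∀ t ∈ Set.Icc (T k) (T (k + 1)), f (γ t) ≤ m := by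
    rintro t ⟨ht1, ht2⟩
    have ht : t ∈ Set.Icc (0 : ℝ) 1 := ⟨(hT01 k hk.le).1.trans ht1, ht2.trans (hT01 (k + 1) hk).2⟩
    have ht1' : chainLength q k ≤ t * l := (div_le_iff₀ hlen).1 ht1
    have ht2' : t * l ≤ chainLength q (k + 1) := (le_div_iff₀ hlen).1 ht2
    have hstep := chainLength_succ q k
    have hqk := hq k hk
    have d1 : dist (γ t) (q k) ≤ r + ρ := by
      refine (hγq k hk.le t ht).trans (add_le_add_left ?_ ρ)
      rw [abs_le]; constructor <;> linarith
    have d2 : dist (γ t) (q (k + 1)) ≤ r + ρ := by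
      refine (hγq (k + 1) hk t ht).trans (add_le_add_left ?_ ρ)
      rw [abs_le]; constructor <;> linarith
    have f1 := (abs_le.1 ((hf (γ t) (q k)).trans (mul_le_mul_of_nonneg_left d1 hB))).2
    have f2 := (abs_le.1 ((hf (γ t) (q (k + 1))).trans (mul_le_mul_of_nonneg_left d2 hB))).2
    rw [hm]; linarith
  have hle : ∫ t in T k..T (k + 1), f (γ t) ≤ m * (T (k + 1) - T k) := by
    have := intervalIntegral.integral_mono_on (hTm (Nat.le_succ k)) (hint k hk)
      intervalIntegrable_const hpt
    rwa [intervalIntegral.integral_const, smul_eq_mul, mul_comm] at this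
  have hd : l * (T (k + 1) - T k) = dist (q k) (q (k + 1)) := by
    simp only [hT]
    rw [chainLength_succ]
    field_simp
    ring
  calc l * ∫ t in T k..T (k + 1), f (γ t) ≤ l * (m * (T (k + 1) - T k)) := by gcongr
    _ = m * dist (q k) (q (k + 1)) := by rw [← hd]; ring
    _ = _ := by rw [hm]; ring

end ChainLength

/-! ### Total boundedness of chains of bounded cost -/

section Compactness

variable {X : Type*} [MetricSpace X]

/-- Chains of bounded cost that start in a compact set stay close to a compact set: leaving the
neighbourhood of `K m`, outside of which the running cost is at least `m`, is expensive. -/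
theorem infDist_le_of_chainCost_le {G : X → ℝ} (hG0 : ∀ x, 0 ≤ G x) {K : Set X} {η m A : ℝ}
    (hη : 0 ≤ η) (hm : 0 < m) (hG : ∀ x, η < Metric.infDist x K → m ≤ G x) {N : ℕ} {q : ℕ → X}
    (hq0 : q 0 ∈ K) (hA : chainCost G N q ≤ A) {k : ℕ} (hk : k ≤ N) :
    Metric.infDist (q k) K ≤ η + 2 / m * A := by
  have key : ∀ k, max 0 (Metric.infDist (q k) K - η) ≤ 2 / m * chainCost G k q := by
    intro k
    induction k with
    | zero => simp [Metric.infDist_zero_of_mem hq0, chainCost, hη]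
    | succ k ih =>
      have hs : chainCost G (k + 1) q = chainCost G k q +
          (G (q k) + G (q (k + 1))) / 2 * dist (q k) (q (k + 1)) := Finset.sum_range_succ _ _
      rw [hs, mul_add]
      have hd := Metric.infDist_le_infDist_add_dist (s := K) (x := q (k + 1)) (y := q k)
      rw [dist_comm] at hd
      have hnn : 0 ≤ 2 / m * chainCost G k q :=
        mul_nonneg (by positivity) (chainCost_nonneg hG0 _ _)
      have hnn' : 0 ≤ 2 / m * ((G (q k) + G (q (k + 1))) / 2 * dist (q k) (q (k + 1))) :=
        mul_nonneg (by positivity) (mul_nonneg (by linarith [hG0 (q k), hG0 (q (k + 1))])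
          dist_nonneg)
      have hi := (le_max_right 0 (Metric.infDist (q k) K - η)).trans ih
      refine max_le (by linarith) ?_
      rcases le_or_gt (Metric.infDist (q (k + 1)) K) η with h1 | h1
      · linarith
      · have hm1 : m ≤ G (q k) + G (q (k + 1)) := by linarith [hG _ h1, hG0 (q k)]
        have : dist (q k) (q (k + 1)) ≤
            2 / m * ((G (q k) + G (q (k + 1))) / 2 * dist (q k) (q (k + 1))) := by
          rw [show 2 / m * ((G (q k) + G (q (k + 1))) / 2 * dist (q k) (q (k + 1))) =
            (G (q k) + G (q (k + 1))) / m * dist (q k) (q (k + 1)) by ring]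
          exact le_mul_of_one_le_left dist_nonneg ((one_le_div hm).2 hm1)
        linarith
  have h1 := (le_max_right _ _).trans (key k)
  have h2 : chainCost G k q ≤ A := by
    refine le_trans ?_ hA
    exact Finset.sum_le_sum_of_subset_of_nonneg (Finset.range_mono hk) fun i _ _ =>
      mul_nonneg (by linarith [hG0 (q i), hG0 (q (i + 1))]) dist_nonneg
  have h3 : 2 / m * chainCost G k q ≤ 2 / m * A := by gcongr
  linarith

/-- A union of finite sets is totally bounded if, at every scale, all but finitely many of them lie
near a compact set. -/
theorem totallyBounded_iUnion_of_infDist_le {S : ℕ → Set X} (hS : ∀ n, (S n).Finite)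
    (h : ∀ ε > 0, ∃ K : Set X, IsCompact K ∧ K.Nonempty ∧
      ∀ᶠ n in atTop, ∀ x ∈ S n, Metric.infDist x K < ε) :
    TotallyBounded (⋃ n, S n) := by
  refine Metric.totallyBounded_iff.2 fun ε hε => ?_
  obtain ⟨K, hK, hKne, hev⟩ := h (ε / 2) (half_pos hε)
  obtain ⟨n₀, hn₀⟩ := eventually_atTop.1 hev
  obtain ⟨t, ht, hKt⟩ := Metric.totallyBounded_iff.1 hK.totallyBounded (ε / 2) (half_pos hε)
  refine ⟨t ∪ ⋃ n ∈ Finset.range n₀, S n,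
    ht.union (Set.Finite.biUnion (Finset.finite_toSet _) fun n _ => hS n), ?_⟩
  rintro x hx
  obtain ⟨n, hn⟩ := Set.mem_iUnion.1 hx
  rcases lt_or_ge n n₀ with hlt | hge
  · refine Set.mem_biUnion (Or.inr ?_) (Metric.mem_ball_self hε)
    exact Set.mem_biUnion (Finset.mem_coe.2 (Finset.mem_range.2 hlt)) hn
  · obtain ⟨y, hyK, hxy⟩ := (Metric.infDist_lt_iff hKne).1 (hn₀ n hge x hn)
    obtain ⟨z, hz, hyz⟩ := Set.mem_iUnion₂.1 (hKt hyK)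
    refine Set.mem_biUnion (Or.inl hz) ?_
    have hyz : dist y z < ε / 2 := hyz
    have := dist_triangle x y z
    rw [Metric.mem_ball]
    linarith

end Compactness

/-! ### Limits of chains -/

section LimitCurve

variable {X : Type*} [MetricSpace X]

theorem natCast_le_toReal_lipTrunc {G : X → ℝ≥0∞} {K : Set X} {m : ℕ}
    (hKG : ∀ x ∉ K, (m : ℝ≥0∞) ≤ G x) {n : ℕ} {η : ℝ} (hmn : m ≤ n) (hmη : m ≤ n * η)
    {x : X} (hx : η < Metric.infDist x K) : (m : ℝ) ≤ (lipTrunc G n x).toReal := by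
  have : (m : ℝ≥0∞) ≤ lipTrunc G n x := by
    refine le_lipTrunc (r := ENNReal.ofReal η) (fun y hy => hKG y fun hyK => ?_)
      (by exact_mod_cast hmn) ?_
    · rw [edist_lt_ofReal] at hy
      exact absurd (Metric.infDist_le_dist_of_mem (x := x) hyK) (by linarith)
    · rw [← ENNReal.ofReal_natCast, ← ENNReal.ofReal_natCast n,
        ← ENNReal.ofReal_mul (by positivity)]
      exact ENNReal.ofReal_le_ofReal hmη
  simpa using ENNReal.toReal_mono (lipTrunc_ne_top G n x) this

theorem le_toReal_lipTrunc {G : X → ℝ≥0∞} {δ : ℝ≥0} (hδG : ∀ x, (δ : ℝ≥0∞) ≤ G x) {n : ℕ}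
    (hn : δ ≤ n) (x : X) : (δ : ℝ) ≤ (lipTrunc G n x).toReal := by
  have hn' : (δ : ℝ≥0∞) ≤ n := by exact_mod_cast hn
  have : (δ : ℝ≥0∞) ≤ lipTrunc G n x :=
    le_lipTrunc (r := 1) (fun y _ => hδG y) hn' (by simpa using hn')
  simpa using ENNReal.toReal_mono (lipTrunc_ne_top G n x) this

/-- Chains of bounded cost that start in a compact set form a totally bounded family, when the
running costs increase to a function that is large outside compact sets. -/
theorem totallyBounded_chains {G : X → ℝ≥0∞} {Km : ℕ → Set X} (hKm : ∀ m, IsCompact (Km m))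
    (hKmG : ∀ m, ∀ x ∉ Km m, (m : ℝ≥0∞) ≤ G x) {K : Set X} (hK : IsCompact K) {N : ℕ → ℕ}
    {q : ℕ → ℕ → X} (hq0 : ∀ n, q n 0 ∈ K) {A : ℝ}
    (hA : ∀ n, chainCost (fun x => (lipTrunc G n x).toReal) (N n) (q n) ≤ A) :
    TotallyBounded (⋃ n, q n '' Set.Iic (N n)) := by
  have hA0 : 0 ≤ A := (chainCost_nonneg (fun _ => ENNReal.toReal_nonneg) _ _).trans (hA 0)
  refine totallyBounded_iUnion_of_infDist_le (fun n => (Set.finite_Iic _).image _) fun ε hε => ?_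
  obtain ⟨m, hm⟩ := exists_nat_gt (4 * A / ε)
  have hm0 : (0 : ℝ) < m := lt_of_le_of_lt (by positivity) hm
  refine ⟨K ∪ Km m, hK.union (hKm m), ⟨q 0 0, Or.inl (hq0 0)⟩, ?_⟩
  obtain ⟨n₁, hn₁⟩ := exists_nat_ge (m / (ε / 4))
  filter_upwards [eventually_ge_atTop m, eventually_ge_atTop n₁] with n hmn hn
  rintro _ ⟨k, hk, rfl⟩
  have hmη : (m : ℝ) ≤ n * (ε / 4) := by
    have : (n₁ : ℝ) ≤ n := by exact_mod_cast hn
    exact (div_le_iff₀ (by positivity)).1 (hn₁.trans this)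
  have h1 := infDist_le_of_chainCost_le (G := fun x => (lipTrunc G n x).toReal)
    (fun _ => ENNReal.toReal_nonneg) (by positivity : 0 ≤ ε / 4) hm0
    (fun x hx => natCast_le_toReal_lipTrunc (K := K ∪ Km m)
      (fun y hy => hKmG m y fun h => hy (Or.inr h)) hmn hmη hx)
    (Or.inl (hq0 n)) (hA n) hk
  have h2 : 2 / m * A < ε / 2 := by
    rw [div_lt_iff₀ hε] at hm
    rw [div_mul_eq_mul_div, div_lt_iff₀ hm0]
    linarith
  linarith

/-- A totally bounded family of chains of bounded length and vanishing mesh converges, along every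
ultrafilter, to a Lipschitz curve on `[0, 1]`, uniformly after rescaling the lengths. -/
theorem exists_lipschitz_curve_shadowing [CompleteSpace X] {N : ℕ → ℕ} {q : ℕ → ℕ → X}
    (hq : ∀ n : ℕ, IsChainOfSize (1 / ((n : ℝ) + 1)) (N n) (q n))
    (htb : TotallyBounded (⋃ n, q n '' Set.Iic (N n))) {L : ℝ}
    (hL : ∀ᶠ n : ℕ in atTop, chainLength (q n) (N n) ≤ L) (U : Ultrafilter ℕ)
    (hU : (U : Filter ℕ) ≤ atTop) :
    ∃ (γ : ℝ → X) (C : ℝ≥0), LipschitzOnWith C γ (Set.Icc 0 1) ∧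
      Tendsto (fun n : ℕ => chainLength (q n) (N n)) U (𝓝 C) ∧
      ∀ η > 0, ∀ᶠ n in (U : Filter ℕ), ∀ k ≤ N n, ∀ t ∈ Set.Icc (0 : ℝ) 1,
        dist (γ t) (q n k) ≤ |t * chainLength (q n) (N n) - chainLength (q n) k| + η := by
  set l : ℕ → ℝ := fun n => chainLength (q n) (N n) with hl
  have hl0 : ∀ n, 0 ≤ l n := fun n => chainLength_nonneg _ _
  have hr0 : ∀ n : ℕ, (0 : ℝ) ≤ 1 / ((n : ℝ) + 1) := fun n => by positivity
  have hrlim : Tendsto (fun n : ℕ => 1 / ((n : ℝ) + 1)) U (𝓝 0) :=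
    tendsto_one_div_add_atTop_nhds_zero_nat.mono_left hU
  have hLU : ∀ᶠ n in (U : Filter ℕ), l n ≤ L := hU hL
  -- the point of the `n`-th chain at the fraction `t` of its length
  have hex : ∀ (n : ℕ) (t : ℝ), ∃ k ≤ N n, t ∈ Set.Icc (0 : ℝ) 1 →
      |chainLength (q n) k - t * l n| ≤ 1 / ((n : ℝ) + 1) := by
    intro n t
    by_cases ht : t ∈ Set.Icc (0 : ℝ) 1
    · obtain ⟨k, hk, hk'⟩ := exists_abs_chainLength_sub_le (hr0 n) (hq n) (τ := t * l n)
        ⟨mul_nonneg ht.1 (hl0 n), mul_le_of_le_one_left (hl0 n) ht.2⟩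
      exact ⟨k, hk, fun _ => hk'⟩
    · exact ⟨0, Nat.zero_le _, fun h => absurd h ht⟩
  choose κ hκN hκ using hex
  have hcomp : IsCompact (closure (⋃ n, q n '' Set.Iic (N n))) :=
    htb.closure.isCompact_of_isClosed isClosed_closure
  have hlim : ∀ t, ∃ x, Tendsto (fun n => q n (κ n t)) U (𝓝 x) := by
    intro t
    obtain ⟨x, -, hx⟩ := hcomp.ultrafilter_le_nhds (U.map fun n => q n (κ n t))
      (tendsto_principal.2 (Eventually.of_forall fun n =>
        subset_closure (Set.mem_iUnion.2 ⟨n, κ n t, hκN n t, rfl⟩)))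
    exact ⟨x, hx⟩
  choose γ hγ using hlim
  obtain ⟨C, hC0, hC⟩ : ∃ C : ℝ, 0 ≤ C ∧ Tendsto l U (𝓝 C) := by
    obtain ⟨C, hC, h⟩ := (isCompact_Icc (a := (0 : ℝ)) (b := L)).ultrafilter_le_nhds (U.map l)
      (tendsto_principal.2 (hLU.mono fun n hn => ⟨hl0 n, hn⟩))
    exact ⟨C, hC.1, h⟩
  have hLipγ : ∀ s ∈ Set.Icc (0 : ℝ) 1, ∀ t ∈ Set.Icc (0 : ℝ) 1,
      dist (γ s) (γ t) ≤ C * |s - t| := by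
    intro s hs t ht
    have h1 : Tendsto (fun n => dist (q n (κ n s)) (q n (κ n t))) U (𝓝 (dist (γ s) (γ t))) :=
      (hγ s).dist (hγ t)
    have h2 : Tendsto (fun n : ℕ => l n * |s - t| + 2 * (1 / ((n : ℝ) + 1))) U
        (𝓝 (C * |s - t| + 2 * 0)) := (hC.mul_const _).add (hrlim.const_mul 2)
    rw [mul_zero, add_zero] at h2
    refine le_of_tendsto_of_tendsto' h1 h2 fun n => ?_
    refine (dist_le_abs_chainLength_sub _ _ _).trans ?_
    have e1 := hκ n s hs
    have e2 := hκ n t ht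
    have e3 : |s * l n - t * l n| = l n * |s - t| := by
      rw [← sub_mul, abs_mul, abs_of_nonneg (hl0 n), mul_comm]
    rw [abs_sub_comm] at e2
    have := abs_sub_le (chainLength (q n) (κ n s)) (s * l n) (chainLength (q n) (κ n t))
    have := abs_sub_le (s * l n) (t * l n) (chainLength (q n) (κ n t))
    linarith
  refine ⟨γ, ⟨C, hC0⟩, LipschitzOnWith.of_dist_le_mul fun s hs t ht => hLipγ s hs t ht, hC, ?_⟩
  intro η hη
  -- a finite net of times suffices, since the chains and the limit are uniformly Lipschitz
  set c := max L C + 1 with hc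
  have hcpos : 0 < c := by have := le_max_right L C; linarith
  obtain ⟨S, hS01, hSfin, hS⟩ := Metric.finite_approx_of_totallyBounded
    (isCompact_Icc (a := (0 : ℝ)) (b := 1)).totallyBounded (η / (8 * c)) (by positivity)
  have hev : ∀ᶠ n in (U : Filter ℕ), ∀ s ∈ S, dist (q n (κ n s)) (γ s) < η / 4 :=
    (Filter.eventually_all_finite hSfin).2 fun s _ =>
      (hγ s).eventually (Metric.ball_mem_nhds _ (by positivity))
  filter_upwards [hev, hLU, hrlim.eventually_le_const (by positivity : 0 < η / 8)]
    with n hn hLn hrn k hk t ht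
  obtain ⟨s, hsS, hts⟩ := Set.mem_iUnion₂.1 (hS ht)
  have hts : |t - s| ≤ η / (8 * c) := by
    have : dist t s < η / (8 * c) := hts
    rw [Real.dist_eq] at this
    exact this.le
  have hs := hS01 hsS
  have a1 : C * |t - s| ≤ η / 8 := by
    calc C * |t - s| ≤ c * (η / (8 * c)) := by
          refine mul_le_mul ?_ hts (abs_nonneg _) hcpos.le
          linarith [le_max_right L C]
      _ = η / 8 := by field_simp
  have a2 : l n * |t - s| ≤ η / 8 := by
    calc l n * |t - s| ≤ c * (η / (8 * c)) := by
          refine mul_le_mul ?_ hts (abs_nonneg _) hcpos.le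
          linarith [le_max_left L C]
      _ = η / 8 := by field_simp
  have b1 := hLipγ t ht s hs
  have b2 := hn s hsS
  rw [dist_comm] at b2
  have b3 := dist_le_abs_chainLength_sub (q n) (κ n s) k
  have e1 := hκ n s hs
  have e3 : |s * l n - t * l n| = l n * |t - s| := by
    rw [← sub_mul, abs_mul, abs_of_nonneg (hl0 n), mul_comm, abs_sub_comm]
  have c1 := abs_sub_le (chainLength (q n) (κ n s)) (s * l n) (chainLength (q n) k)
  have c2 := abs_sub_le (s * l n) (t * l n) (chainLength (q n) k)
  have d1 := dist_triangle4 (γ t) (γ s) (q n (κ n s)) (q n k)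
  simp only [hl] at *
  linarith

/-- **Compactness of chains and lower semicontinuity of their cost**: chains of vanishing mesh and
bounded cost that start in a compact set converge to a Lipschitz curve along which the integral of
`G` is at most the limit of the costs, computed with the truncations of `G`. -/
theorem exists_limit_curve [CompleteSpace X] {G : X → ℝ≥0∞} (hG : LowerSemicontinuous G)
    {δ : ℝ≥0} (hδ : 0 < δ) (hδG : ∀ x, (δ : ℝ≥0∞) ≤ G x) {Km : ℕ → Set X}
    (hKm : ∀ m, IsCompact (Km m)) (hKmG : ∀ m, ∀ x ∉ Km m, (m : ℝ≥0∞) ≤ G x) {K : Set X}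
    (hK : IsCompact K) {N : ℕ → ℕ} {q : ℕ → ℕ → X}
    (hq : ∀ n : ℕ, IsChainOfSize (1 / ((n : ℝ) + 1)) (N n) (q n)) (hq0 : ∀ n, q n 0 ∈ K) {A : ℝ}
    (hA : ∀ n, chainCost (fun x => (lipTrunc G n x).toReal) (N n) (q n) ≤ A) (U : Ultrafilter ℕ)
    (hU : (U : Filter ℕ) ≤ atTop) :
    ∃ (γ : ℝ → X) (C : ℝ≥0), LipschitzOnWith C γ (Set.Icc 0 1) ∧
      Tendsto (fun n => q n 0) U (𝓝 (γ 0)) ∧ Tendsto (fun n => q n (N n)) U (𝓝 (γ 1)) ∧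
      ∀ a : ℝ, (∀ᶠ n in (U : Filter ℕ),
          chainCost (fun x => (lipTrunc G n x).toReal) (N n) (q n) ≤ a) →
        C * ∫⁻ t in Set.Icc (0 : ℝ) 1, G (γ t) ≤ ENNReal.ofReal a := by
  have hL : ∀ᶠ n : ℕ in atTop, chainLength (q n) (N n) ≤ A / δ := by
    obtain ⟨n₀, hn₀⟩ := exists_nat_ge δ
    filter_upwards [eventually_ge_atTop n₀] with n hn
    rw [le_div_iff₀ (by exact_mod_cast hδ), mul_comm]
    have hδn : δ ≤ n := hn₀.trans (by exact_mod_cast hn)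
    exact (mul_chainLength_le_chainCost (le_toReal_lipTrunc hδG hδn) _ _).trans (hA n)
  obtain ⟨γ, C, hγ, hC, hsh⟩ := exists_lipschitz_curve_shadowing hq
    (totallyBounded_chains hKm hKmG hK hq0 hA) hL U hU
  refine ⟨γ, C, hγ, ?_, ?_, fun a ha => ?_⟩
  · refine Metric.tendsto_nhds.2 fun ε hε => ?_
    filter_upwards [hsh (ε / 2) (half_pos hε)] with n hn
    have := hn 0 (Nat.zero_le _) 0 ⟨le_rfl, zero_le_one⟩
    rw [dist_comm]
    simp only [chainLength, Finset.range_zero, Finset.sum_empty, zero_mul, sub_self, abs_zero,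
      zero_add] at this
    linarith
  · refine Metric.tendsto_nhds.2 fun ε hε => ?_
    filter_upwards [hsh (ε / 2) (half_pos hε)] with n hn
    have := hn (N n) le_rfl 1 ⟨zero_le_one, le_rfl⟩
    rw [dist_comm]
    simp only [one_mul, sub_self, abs_zero, zero_add] at this
    linarith
  have hcont : ∀ j : ℕ, ContinuousOn (fun t => (lipTrunc G j (γ t)).toReal) (Set.Icc 0 1) :=
    fun j => (continuous_toReal_lipTrunc G j).comp_continuousOn hγ.continuousOn
  -- the bound for each truncation, by comparison with the chains
  have hreal : ∀ j : ℕ, C * ∫ t in (0 : ℝ)..1, (lipTrunc G j (γ t)).toReal ≤ a := by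
    intro j
    set I := ∫ t in (0 : ℝ)..1, (lipTrunc G j (γ t)).toReal with hI
    have key : ∀ η > 0, C * I ≤ a + j * (2 * η) * C := by
      intro η hη
      have hr : ∀ᶠ n : ℕ in (U : Filter ℕ), 1 / ((n : ℝ) + 1) ≤ η :=
        hU (tendsto_one_div_add_atTop_nhds_zero_nat.eventually_le_const hη)
      refine le_of_tendsto_of_tendsto (hC.mul_const I) ((hC.const_mul _).const_add a) ?_
      filter_upwards [hsh η hη, hr, hU (eventually_ge_atTop j), ha] with n hn hrn hjn han
      have h1 := chainLength_mul_integral_le (Nat.cast_nonneg j)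
        (fun i hi => (hq n i hi).trans hrn)
        (fun x => ENNReal.toReal_nonneg) (abs_toReal_lipTrunc_sub_le G j) hγ.continuousOn hn
      have h2 : chainCost (fun x => (lipTrunc G j x).toReal) (N n) (q n) ≤
          chainCost (fun x => (lipTrunc G n x).toReal) (N n) (q n) :=
        chainCost_mono (fun x => ENNReal.toReal_mono (lipTrunc_ne_top G n x)
          (monotone_lipTrunc G hjn x)) _ _
      rw [two_mul]
      linarith
    have hlim : Tendsto (fun η : ℝ => a + j * (2 * η) * C) (𝓝[>] 0) (𝓝 a) := by
      have : Continuous fun η : ℝ => a + j * (2 * η) * C := by fun_prop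
      simpa using (this.tendsto 0).mono_left nhdsWithin_le_nhds
    refine ge_of_tendsto hlim ?_
    filter_upwards [self_mem_nhdsWithin] with η hη using key η hη
  have hae : ∀ j : ℕ, AEMeasurable (fun t => lipTrunc G j (γ t))
      (volume.restrict (Set.Icc (0 : ℝ) 1)) := by
    intro j
    have := ((hcont j).aemeasurable (μ := volume) measurableSet_Icc).ennreal_ofReal
    simpa only [ENNReal.ofReal_toReal (lipTrunc_ne_top G j _)] using this
  have hlint : ∀ j : ℕ, C * ∫⁻ t in Set.Icc (0 : ℝ) 1, lipTrunc G j (γ t) ≤ ENNReal.ofReal a := by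
    intro j
    have h1 : ∫⁻ t in Set.Icc (0 : ℝ) 1, lipTrunc G j (γ t) =
        ENNReal.ofReal (∫ t in (0 : ℝ)..1, (lipTrunc G j (γ t)).toReal) := by
      rw [intervalIntegral.integral_of_le zero_le_one, ← integral_Icc_eq_integral_Ioc,
        ofReal_integral_eq_lintegral_ofReal ((hcont j).integrableOn_compact isCompact_Icc)
          (Eventually.of_forall fun t => ENNReal.toReal_nonneg)]
      simp only [ENNReal.ofReal_toReal (lipTrunc_ne_top G j _)]
    rw [h1, ← ENNReal.ofReal_coe_nnreal, ← ENNReal.ofReal_mul C.coe_nonneg]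
    exact ENNReal.ofReal_le_ofReal (hreal j)
  simp only [← iSup_lipTrunc hG]
  rw [lintegral_iSup' hae (Eventually.of_forall fun t _ _ h => monotone_lipTrunc G h (γ t)),
    ENNReal.mul_iSup]
  exact iSup_le hlint

end LimitCurve

/-! ### Lipschitz approximation of bounded functions -/

section Approximation

variable {X : Type*} [MetricSpace X] [CompleteSpace X] [MeasurableSpace X]

/-- The discrete value functions do not drop below the boundary values in the limit: otherwise
chains of too small cost would converge to a curve that violates the upper gradient inequality. -/
theorem eventually_le_chainInf {u : X → ℝ} {M : ℝ} (hu : ∀ x, |u x| ≤ M) {g : X → ℝ≥0∞}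
    (hug : IsUpperGradientOffPoles u g) {G : X → ℝ≥0∞} (hG : LowerSemicontinuous G)
    (hgG : ∀ x, g x ≤ G x) {δ : ℝ≥0} (hδ : 0 < δ) (hδG : ∀ x, (δ : ℝ≥0∞) ≤ G x)
    {Km : ℕ → Set X} (hKm : ∀ m, IsCompact (Km m)) (hKmG : ∀ m, ∀ x ∉ Km m, (m : ℝ≥0∞) ≤ G x)
    {K : Set X} (hK : IsCompact K) (huK : ContinuousOn u K) (hgK : ∀ x ∈ K, g x < ∞) {x : X}
    (hx : x ∈ K) {c : ℝ} (hc : 0 < c) :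
    ∀ᶠ n : ℕ in atTop, u x - c ≤
      chainInf (1 / ((n : ℝ) + 1)) (fun y => (lipTrunc G n y).toReal) K u M x := by
  by_contra hcon
  obtain ⟨φ, hφ, hφlt⟩ := extraction_of_frequently_atTop (not_eventually.1 hcon)
  have hex : ∀ k : ℕ, ∃ (N : ℕ) (q : ℕ → X), IsChainOfSize (1 / ((k : ℝ) + 1)) N q ∧ q 0 ∈ K ∧
      q N = x ∧ chainCost (fun y => (lipTrunc G k y).toReal) N q ≤ u x - c - u (q 0) := by
    intro k
    have hkφ : k ≤ φ k := hφ.le_apply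
    obtain ⟨t, ht, htlt⟩ := exists_lt_of_csInf_lt ⟨M, Or.inl rfl⟩ (not_le.1 (hφlt k))
    rcases ht with rfl | ⟨N, q, hq, hq0, hqN, rfl⟩
    · exact absurd (hu x) (by have := le_abs_self (u x); linarith)
    · refine ⟨N, q, fun i hi => (hq i hi).trans ?_, hq0, hqN, ?_⟩
      · have : (k : ℝ) ≤ φ k := by exact_mod_cast hkφ
        exact one_div_le_one_div_of_le (by positivity) (by linarith)
      · have h1 : chainCost (fun y => (lipTrunc G k y).toReal) N q ≤
            chainCost (fun y => (lipTrunc G (φ k) y).toReal) N q :=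
          chainCost_mono (fun y => ENNReal.toReal_mono (lipTrunc_ne_top G _ y)
            (monotone_lipTrunc G hkφ y)) _ _
        linarith
  choose N q hq hq0 hqN hcost using hex
  have hA : ∀ k, chainCost (fun y => (lipTrunc G k y).toReal) (N k) (q k) ≤ 2 * M := by
    intro k
    linarith [hcost k, (abs_le.1 (hu x)).2, (abs_le.1 (hu (q k 0))).1]
  obtain ⟨γ, C, hγ, hγ0, hγ1, hγG⟩ := exists_limit_curve hG hδ hδG hKm hKmG hK hq hq0 hA
    (hyperfilter ℕ) Nat.hyperfilter_le_atTop
  have h1x : γ 1 = x := by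
    refine tendsto_nhds_unique hγ1 ?_
    simp only [hqN]
    exact tendsto_const_nhds
  have h0K : γ 0 ∈ K := hK.isClosed.mem_of_tendsto hγ0 (Eventually.of_forall hq0)
  have hu0 : Tendsto (fun k => u (q k 0)) (hyperfilter ℕ) (𝓝 (u (γ 0))) :=
    (huK (γ 0) h0K).tendsto.comp
      (tendsto_nhdsWithin_iff.2 ⟨hγ0, Eventually.of_forall hq0⟩)
  set a := u x - u (γ 0) - c / 2 with ha
  have hev : ∀ᶠ k in (hyperfilter ℕ : Filter ℕ),
      chainCost (fun y => (lipTrunc G k y).toReal) (N k) (q k) ≤ a := by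
    filter_upwards [hu0.eventually (lt_mem_nhds (show u (γ 0) - c / 2 < u (γ 0) by linarith))]
      with k hk
    linarith [hcost k]
  obtain ⟨k, hk⟩ := hev.exists
  have ha0 : 0 ≤ a := (chainCost_nonneg (fun _ => ENNReal.toReal_nonneg) _ _).trans hk
  have hineq : ‖u (γ 1) - u (γ 0)‖ₑ ≤ ENNReal.ofReal a := by
    refine (hug.2 γ 0 1 (isRectifiableCurve_of_lipschitzOnWith zero_lt_one hγ) (hgK _ h0K)
      (h1x ▸ hgK x hx)).trans ?_
    refine (curveLIntegral_le_of_lipschitzOnWith zero_lt_one hγ g).trans (le_trans ?_ (hγG a hev))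
    exact mul_le_mul_right (lintegral_mono fun t => hgG _) _
  rw [h1x, ← ofReal_norm, ENNReal.ofReal_le_ofReal_iff ha0, Real.norm_eq_abs] at hineq
  have := le_abs_self (u x - u (γ 0))
  linarith

/-- **Lipschitz approximation in energy** for bounded functions and finite measures. -/
theorem exists_lipschitz_approx [TopologicalSpace.SeparableSpace X] [BorelSpace X]
    (ν : Measure X) [IsFiniteMeasure ν] {p : ℝ≥0∞} (hp : 1 ≤ p) (hp' : p < ∞) {u : X → ℝ}
    (hum : AEMeasurable u ν) {M : ℝ} (hu : ∀ x, |u x| ≤ M) {g : X → ℝ≥0∞}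
    (hug : IsUpperGradientOffPoles u g) {E : ℝ≥0∞} (hE : eLpNorm g p ν < E) {η : ℝ≥0∞}
    (hη : η ≠ 0) :
    ∃ v : X → ℝ, (∃ C, LipschitzWith C v) ∧ eLpNorm (lip v) p ν ≤ E ∧
      eLpNorm (fun x => v x - u x) p ν ≤ η := by
  have hp0 : p ≠ 0 := (zero_lt_one.trans_le hp).ne'
  set s := p.toReal with hs
  have hs0 : 0 < s := ENNReal.toReal_pos hp0 hp'.ne
  have hroot : ∀ {a b : ℝ≥0∞}, a ≤ b ^ s → a ^ (1 / s) ≤ b := fun {a b} h => by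
    rw [one_div]; exact (ENNReal.rpow_inv_le_iff hs0).2 h
  have hgE : ∫⁻ x, g x ^ s ∂ν < E ^ s := by
    rw [eLpNorm_eq_lintegral_rpow_enorm_toReal hp0 hp'.ne, one_div,
      ENNReal.rpow_inv_lt_iff hs0] at hE
    simpa using hE
  obtain ⟨G, hG, hgG, hGE, ⟨δ, hδ, hδG⟩, Km, hKm, hKmG⟩ :=
    exists_lowerSemicontinuous_majorant ν hs0 hug.1 hgE
  have hgfin : ∀ᵐ x ∂ν, x ∈ {x | g x < ∞} := by
    filter_upwards [ae_lt_top (hug.1.pow_const s) (hgE.trans_le le_top).ne] with x hx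
    by_contra h
    have h : ¬ g x < ∞ := h
    rw [not_lt, top_le_iff] at h
    rw [h, ENNReal.top_rpow_of_pos hs0] at hx
    exact lt_irrefl _ hx
  set B := ENNReal.ofReal (2 * M) ^ s with hB
  have hBtop : B ≠ ∞ := ENNReal.rpow_ne_top_of_nonneg hs0.le ENNReal.ofReal_ne_top
  have hηs : η ^ s ≠ 0 := by simp [ENNReal.rpow_eq_zero_iff, hη, hs0.not_gt]
  have hη2 : η ^ s / 2 ≠ 0 := (ENNReal.half_pos hηs).ne'
  obtain ⟨K, hKg, hK, huK, hKν⟩ := exists_isCompact_continuousOn ν hum hgfin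
    (ε := η ^ s / 2 / B) (ENNReal.div_pos hη2 hBtop).ne'
  set v : ℕ → X → ℝ := fun n =>
    chainInf (1 / ((n : ℝ) + 1)) (fun y => (lipTrunc G n y).toReal) K u M with hv
  have hr : ∀ n : ℕ, (0 : ℝ) < 1 / ((n : ℝ) + 1) := fun n => by positivity
  have hG0 : ∀ (n : ℕ) x, 0 ≤ (lipTrunc G n x).toReal := fun _ _ => ENNReal.toReal_nonneg
  have hvLip : ∀ n, ∃ C, LipschitzWith C (v n) := fun n =>
    exists_lipschitzWith_chainInf (hr n) (hG0 n) hu (toReal_lipTrunc_le_natCast G n)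
  have hvcont : ∀ n, Continuous (v n) := fun n => (hvLip n).choose_spec.continuous
  have hlip : ∀ n x, lip (v n) x ≤ G x := by
    intro n x
    refine (lip_chainInf_le (hr n) (hG0 n) hu (abs_toReal_lipTrunc_sub_le G n) x).trans ?_
    rw [ENNReal.ofReal_toReal (lipTrunc_ne_top G n x)]
    exact lipTrunc_le G n x
  have hbound : ∀ n x, ‖v n x - u x‖ₑ ^ s ≤ B := by
    intro n x
    refine ENNReal.rpow_le_rpow ?_ hs0.le
    rw [← ofReal_norm, Real.norm_eq_abs]
    refine ENNReal.ofReal_le_ofReal ((abs_sub _ _).trans ?_)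
    have : |v n x| ≤ M := abs_chainInf_le (hG0 n) hu x
    linarith [hu x]
  have hpt : ∀ x ∈ K, Tendsto (fun n => v n x) atTop (𝓝 (u x)) := by
    intro x hx
    refine tendsto_order.2 ⟨fun b hb => ?_, fun b hb => ?_⟩
    · filter_upwards [eventually_le_chainInf hu hug hG hgG hδ hδG hKm hKmG hK huK hKg hx
        (half_pos (sub_pos.2 hb))] with n hn
      have : u x - (u x - b) / 2 ≤ v n x := hn
      linarith
    · exact Eventually.of_forall fun n => (chainInf_le_of_mem (hG0 n) hu hx).trans_lt hb
  have hmeas : ∀ n, AEMeasurable (fun x => ‖v n x - u x‖ₑ ^ s) ν := fun n =>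
    (((hvcont n).measurable.aemeasurable.sub hum).enorm).pow_const s
  have hlim : Tendsto (fun n => ∫⁻ x in K, ‖v n x - u x‖ₑ ^ s ∂ν) atTop (𝓝 0) := by
    have := tendsto_lintegral_of_dominated_convergence' (μ := ν.restrict K) (f := fun _ => 0)
      (fun _ => B) (fun n => (hmeas n).restrict)
      (fun n => Eventually.of_forall (hbound n))
      (by rw [lintegral_const]; exact ENNReal.mul_ne_top hBtop (measure_ne_top _ _))
      (by
        filter_upwards [ae_restrict_mem hK.measurableSet] with x hx
        have h1 := ((hpt x hx).sub_const (u x)).enorm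
        rw [sub_self, enorm_zero] at h1
        have h2 := (ENNReal.continuous_rpow_const (y := s)).tendsto 0 |>.comp h1
        rwa [ENNReal.zero_rpow_of_pos hs0] at h2)
    simpa using this
  obtain ⟨n, hn⟩ := (hlim.eventually_le_const (pos_iff_ne_zero.2 hη2)).exists
  refine ⟨v n, hvLip n, ?_, ?_⟩
  · rw [eLpNorm_eq_lintegral_rpow_enorm_toReal hp0 hp'.ne]
    refine hroot (le_trans (lintegral_mono fun x => ?_) hGE)
    exact ENNReal.rpow_le_rpow (hlip n x) hs0.le
  · rw [eLpNorm_eq_lintegral_rpow_enorm_toReal hp0 hp'.ne]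
    refine hroot ?_
    rw [← lintegral_add_compl _ hK.measurableSet, ← ENNReal.add_halves (η ^ s)]
    refine add_le_add hn ?_
    calc ∫⁻ x in Kᶜ, ‖v n x - u x‖ₑ ^ s ∂ν ≤ ∫⁻ _ in Kᶜ, B ∂ν := lintegral_mono (hbound n)
      _ = B * ν Kᶜ := setLIntegral_const _ _
      _ ≤ B * (η ^ s / 2 / B) := by gcongr
      _ ≤ η ^ s / 2 := ENNReal.mul_div_le

end Approximation

/-! ### Truncations and dominated convergence -/

section Convergence

theorem tendsto_ofReal_inv_mul {a : ℝ≥0∞} (ha : a ≠ ∞) :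
    Tendsto (fun k : ℕ => ENNReal.ofReal ((k : ℝ) + 1)⁻¹ * a) atTop (𝓝 0) := by
  have h1 : Tendsto (fun k : ℕ => ((k : ℝ) + 1)⁻¹) atTop (𝓝 0) := by
    simpa only [one_div] using tendsto_one_div_add_atTop_nhds_zero_nat (𝕜 := ℝ)
  simpa using ENNReal.Tendsto.mul_const (ENNReal.tendsto_ofReal h1) (Or.inr ha)

variable {X : Type*}

/-- The truncation of a function at height `M`. -/
def truncate (M : ℝ) (u : X → ℝ) (x : X) : ℝ := max (min (u x) M) (-M)

theorem abs_truncate_sub_le (M : ℝ) (u : X → ℝ) (x y : X) :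
    |truncate M u x - truncate M u y| ≤ |u x - u y| := by
  refine (abs_max_sub_max_le_abs _ _ _).trans ((abs_min_sub_min_le_max _ _ _ _).trans ?_)
  simp

theorem abs_truncate_le {M : ℝ} (hM : 0 ≤ M) (u : X → ℝ) (x : X) : |truncate M u x| ≤ M :=
  abs_le.2 ⟨le_max_right _ _, max_le (min_le_right _ _) (by linarith)⟩

theorem abs_truncate_le_abs {M : ℝ} (hM : 0 ≤ M) (u : X → ℝ) (x : X) :
    |truncate M u x| ≤ |u x| :=
  abs_le.2 ⟨le_max_iff.2 (Or.inl (le_min (neg_abs_le _) (by linarith [abs_nonneg (u x)]))),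
    max_le ((min_le_left _ _).trans (le_abs_self _)) (by linarith [abs_nonneg (u x)])⟩

theorem truncate_eq_self {M : ℝ} {u : X → ℝ} {x : X} (h : |u x| ≤ M) : truncate M u x = u x := by
  rw [truncate, min_eq_left (abs_le.1 h).2, max_eq_left (abs_le.1 h).1]

variable [MeasurableSpace X]

/-- The Lebesgue dominated convergence theorem in `L^p`, for functions dominated by their limit. -/
theorem tendsto_eLpNorm_sub_of_dominated {μ : Measure X} {p : ℝ≥0∞} (hp : p ≠ 0) (hp' : p ≠ ∞)
    {v : X → ℝ} (hv : MemLp v p μ) {f : ℕ → X → ℝ} (hf : ∀ k, AEStronglyMeasurable (f k) μ)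
    (hfv : ∀ k x, |f k x| ≤ |v x|) (hlim : ∀ x, Tendsto (fun k => f k x) atTop (𝓝 (v x))) :
    Tendsto (fun k => eLpNorm (fun x => f k x - v x) p μ) atTop (𝓝 0) := by
  set s := p.toReal with hs
  have hs0 : 0 < s := ENNReal.toReal_pos hp hp'
  have h2v : MemLp (fun x => 2 * v x) p μ := hv.const_mul 2
  have hfin : ∫⁻ x, ‖2 * v x‖ₑ ^ s ∂μ ≠ ∞ :=
    (lintegral_rpow_enorm_lt_top_of_eLpNorm_lt_top hp hp' h2v.2).ne
  have key : Tendsto (fun k => ∫⁻ x, ‖f k x - v x‖ₑ ^ s ∂μ) atTop (𝓝 0) := by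
    have := tendsto_lintegral_of_dominated_convergence' (μ := μ) (f := fun _ => 0)
      (F := fun k x => ‖f k x - v x‖ₑ ^ s) (fun x => ‖2 * v x‖ₑ ^ s)
      (fun k => ((hf k).sub hv.1).enorm.pow_const s)
      (fun k => Eventually.of_forall fun x => ENNReal.rpow_le_rpow ?_ hs0.le) hfin
      (Eventually.of_forall fun x => ?_)
    · simpa using this
    · rw [← ofReal_norm, ← ofReal_norm, Real.norm_eq_abs, Real.norm_eq_abs, abs_mul, abs_two]
      refine ENNReal.ofReal_le_ofReal ((abs_sub _ _).trans ?_)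
      linarith [hfv k x]
    · have h1 := ((hlim x).sub_const (v x)).enorm
      rw [sub_self, enorm_zero] at h1
      have h2 := (ENNReal.continuous_rpow_const (y := s)).tendsto 0 |>.comp h1
      rwa [ENNReal.zero_rpow_of_pos hs0] at h2
  have h3 := (ENNReal.continuous_rpow_const (y := 1 / s)).tendsto 0 |>.comp key
  rw [ENNReal.zero_rpow_of_pos (by positivity)] at h3
  refine h3.congr fun k => ?_
  rw [eLpNorm_eq_lintegral_rpow_enorm_toReal hp hp']
  rfl

end Convergence

/-! ### Cutoff functions -/

section Cutoff

variable {X : Type*} [MetricSpace X]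

/-- The cutoff function that is `1` on the ball of radius `R`, vanishes outside the ball of radius
`2 * R`, and is `1 / R`-Lipschitz. -/
def cutoff (x₀ : X) (R : ℝ) (x : X) : ℝ :=
  max 0 (min 1 (2 - dist x x₀ / R))

theorem cutoff_nonneg (x₀ : X) (R : ℝ) (x : X) : 0 ≤ cutoff x₀ R x := le_max_left _ _

theorem cutoff_le_one (x₀ : X) (R : ℝ) (x : X) : cutoff x₀ R x ≤ 1 :=
  max_le zero_le_one (min_le_left _ _)

theorem cutoff_eq_one {x₀ : X} {R : ℝ} (hR : 0 < R) {x : X} (h : dist x x₀ ≤ R) :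
    cutoff x₀ R x = 1 := by
  have : dist x x₀ / R ≤ 1 := (div_le_one hR).2 h
  rw [cutoff, min_eq_left (by linarith), max_eq_right zero_le_one]

theorem cutoff_eq_zero {x₀ : X} {R : ℝ} (hR : 0 < R) {x : X}
    (h : x ∉ Metric.closedBall x₀ (2 * R)) : cutoff x₀ R x = 0 := by
  rw [Metric.mem_closedBall, not_le] at h
  have : 2 < dist x x₀ / R := (lt_div_iff₀ hR).2 h
  rw [cutoff, max_eq_left ((min_le_right _ _).trans (by linarith))]

theorem abs_cutoff_sub_le {R : ℝ} (hR : 0 < R) (x₀ x y : X) :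
    |cutoff x₀ R x - cutoff x₀ R y| ≤ R⁻¹ * dist x y := by
  rw [cutoff, cutoff, max_comm 0, max_comm 0]
  refine (abs_max_sub_max_le_abs _ _ _).trans ((abs_min_sub_min_le_max _ _ _ _).trans ?_)
  have hnn : 0 ≤ R⁻¹ * dist x y := mul_nonneg (inv_nonneg.2 hR.le) dist_nonneg
  refine max_le (by simpa) ?_
  rw [show 2 - dist x x₀ / R - (2 - dist y x₀ / R) = R⁻¹ * (dist y x₀ - dist x x₀) by
    field_simp; ring, abs_mul, abs_of_pos (inv_pos.2 hR)]
  refine mul_le_mul_of_nonneg_left ?_ (inv_nonneg.2 hR.le)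
  rw [dist_comm x y]
  exact abs_dist_sub_le y x x₀

theorem abs_cutoff_mul_sub_le {R : ℝ} (hR : 0 < R) (x₀ : X) (v : X → ℝ) (x y : X) :
    |cutoff x₀ R y * v y - cutoff x₀ R x * v x| ≤ |v y - v x| + |R⁻¹ * v x| * dist y x := by
  have h1 : cutoff x₀ R y * v y - cutoff x₀ R x * v x =
      cutoff x₀ R y * (v y - v x) + (cutoff x₀ R y - cutoff x₀ R x) * v x := by ring
  rw [h1]
  refine (abs_add_le _ _).trans (add_le_add ?_ ?_)
  · rw [abs_mul, abs_of_nonneg (cutoff_nonneg _ _ _)]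
    exact mul_le_of_le_one_left (abs_nonneg _) (cutoff_le_one _ _ _)
  · rw [abs_mul, abs_mul, abs_of_pos (inv_pos.2 hR)]
    calc _ ≤ R⁻¹ * dist y x * |v x| := by gcongr; exact abs_cutoff_sub_le hR x₀ y x
      _ = _ := by ring

theorem continuous_cutoff (x₀ : X) (R : ℝ) : Continuous (cutoff x₀ R) := by
  unfold cutoff
  fun_prop

theorem exists_lipschitzWith_cutoff_mul {R : ℝ} (hR : 0 < R) (x₀ : X) {v : X → ℝ} {C : ℝ≥0}
    (hv : LipschitzWith C v) : ∃ C', LipschitzWith C' fun x => cutoff x₀ R x * v x := by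
  set B : ℝ := |v x₀| + C * (2 * R) with hB
  have hB0 : 0 ≤ B := by positivity
  have hvB : ∀ x ∈ Metric.closedBall x₀ (2 * R), |v x| ≤ B := by
    intro x hx
    have h1 : |v x - v x₀| ≤ C * dist x x₀ := hv.dist_le_mul x x₀
    have h2 : C * dist x x₀ ≤ C * (2 * R) := by gcongr; exact hx
    have h3 := abs_sub_abs_le_abs_sub (v x) (v x₀)
    linarith
  set C' : ℝ := C + R⁻¹ * B with hC'
  have hC'0 : 0 ≤ C' := by positivity
  have key : ∀ x y, x ∈ Metric.closedBall x₀ (2 * R) →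
      |cutoff x₀ R y * v y - cutoff x₀ R x * v x| ≤ C' * dist y x := by
    intro x y hx
    refine (abs_cutoff_mul_sub_le hR x₀ v x y).trans ?_
    rw [hC', add_mul, abs_mul, abs_of_pos (inv_pos.2 hR)]
    refine add_le_add (hv.dist_le_mul y x) ?_
    gcongr
    exact hvB x hx
  refine ⟨⟨C', hC'0⟩, LipschitzWith.of_dist_le_mul fun y x => ?_⟩
  rw [Real.dist_eq]
  by_cases hx : x ∈ Metric.closedBall x₀ (2 * R)
  · exact key x y hx
  by_cases hy : y ∈ Metric.closedBall x₀ (2 * R)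
  · rw [abs_sub_comm, dist_comm]
    exact key y x hy
  · rw [cutoff_eq_zero hR hx, cutoff_eq_zero hR hy]
    rw [zero_mul, zero_mul, sub_zero, abs_zero]
    exact mul_nonneg hC'0 dist_nonneg

theorem tendsto_cutoff (x₀ x : X) :
    Tendsto (fun k : ℕ => cutoff x₀ ((k : ℝ) + 1) x) atTop (𝓝 1) := by
  refine tendsto_const_nhds.congr' ?_
  obtain ⟨n, hn⟩ := exists_nat_ge (dist x x₀)
  filter_upwards [eventually_ge_atTop n] with k hk
  have : (n : ℝ) ≤ k := by exact_mod_cast hk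
  exact (cutoff_eq_one (by positivity) (by linarith)).symm

/-- The Leibniz rule for the local Lipschitz constant of a product with a cutoff function. -/
theorem lip_cutoff_mul_le {R : ℝ} (hR : 0 < R) (x₀ : X) (v : X → ℝ) (x : X) :
    lip (fun y => cutoff x₀ R y * v y) x ≤ lip v x + ‖R⁻¹ * v x‖ₑ := by
  unfold lip
  simp only [ENNReal.iInf_add]
  refine iInf₂_mono fun ε _ => iSup₂_le fun y hy => ?_
  have h1 : ‖cutoff x₀ R y * v y - cutoff x₀ R x * v x‖ₑ ≤
      ‖v y - v x‖ₑ + ‖R⁻¹ * v x‖ₑ * edist y x := by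
    rw [← ofReal_norm, ← ofReal_norm, ← ofReal_norm, edist_dist,
      ← ENNReal.ofReal_mul (norm_nonneg _), ← ENNReal.ofReal_add (norm_nonneg _)
        (mul_nonneg (norm_nonneg _) dist_nonneg)]
    exact ENNReal.ofReal_le_ofReal (abs_cutoff_mul_sub_le hR x₀ v x y)
  refine (ENNReal.div_le_div_right h1 _).trans ?_
  rw [ENNReal.add_div]
  refine add_le_add ?_ (ENNReal.div_le_of_le_mul le_rfl)
  exact le_iSup₂ (f := fun y (_ : y ∈ Metric.closedBall x ε) => ‖v y - v x‖ₑ / edist y x) y hy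

theorem openSlope_eq_zero {u : X → ℝ} {x₀ : X} {ρ ε : ℝ}
    (hu : ∀ x ∉ Metric.closedBall x₀ ρ, u x = 0) {x : X} (hε : 0 ≤ ε)
    (hx : x ∉ Metric.closedBall x₀ (ρ + ε)) : openSlope ε u x = 0 := by
  rw [Metric.mem_closedBall, not_le] at hx
  refine le_antisymm (iSup₂_le fun y hy => ?_) zero_le
  have hyx : dist y x < ε := hy
  have hyρ : y ∉ Metric.closedBall x₀ ρ := by
    rw [Metric.mem_closedBall, not_le]
    have := dist_triangle x y x₀
    rw [dist_comm x y] at this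
    linarith
  have hxρ : x ∉ Metric.closedBall x₀ ρ := by
    rw [Metric.mem_closedBall, not_le]
    linarith
  simp [hu y hyρ, hu x hxρ]

theorem lip_eq_zero {u : X → ℝ} {x₀ : X} {ρ : ℝ}
    (hu : ∀ x ∉ Metric.closedBall x₀ ρ, u x = 0) {x : X} (hx : x ∉ Metric.closedBall x₀ ρ) :
    lip u x = 0 := by
  rw [Metric.mem_closedBall, not_le] at hx
  refine le_antisymm ?_ zero_le
  have hpos : 0 < (dist x x₀ - ρ) / 2 := by linarith
  refine (lip_le_openSlope hpos u x).trans_eq (openSlope_eq_zero hu hpos.le ?_)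
  rw [Metric.mem_closedBall, not_le]
  linarith

variable [MeasurableSpace X] [BorelSpace X]

theorem eLpNorm_lip_cutoff_mul_le {R : ℝ} (hR : 0 < R) (x₀ : X) {v : X → ℝ} (hv : Continuous v)
    {p : ℝ≥0∞} (hp : 1 ≤ p) (μ : Measure X) :
    eLpNorm (lip fun y => cutoff x₀ R y * v y) p μ ≤
      eLpNorm (lip v) p (μ.restrict (Metric.closedBall x₀ (2 * R))) +
        ENNReal.ofReal R⁻¹ * eLpNorm v p (μ.restrict (Metric.closedBall x₀ (2 * R))) := by
  set B := Metric.closedBall x₀ (2 * R) with hB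
  have hle : ∀ x, ‖lip (fun y => cutoff x₀ R y * v y) x‖ₑ ≤
      ‖B.indicator (fun x => lip v x + ‖R⁻¹ * v x‖ₑ) x‖ₑ := by
    intro x
    simp only [enorm_eq_self]
    by_cases hx : x ∈ B
    · rw [Set.indicator_of_mem hx]
      exact lip_cutoff_mul_le hR x₀ v x
    · rw [lip_eq_zero (fun y hy => by rw [cutoff_eq_zero hR hy, zero_mul]) hx]
      exact zero_le
  refine (eLpNorm_mono_enorm hle).trans ?_
  rw [eLpNorm_indicator_eq_eLpNorm_restrict Metric.isClosed_closedBall.measurableSet]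
  have hm : Continuous fun x => ‖R⁻¹ * v x‖ₑ := (continuous_const.mul hv).enorm
  refine (eLpNorm_add_le (f := lip v) (g := fun x => ‖R⁻¹ * v x‖ₑ)
    (measurable_lip hv).aestronglyMeasurable hm.measurable.aestronglyMeasurable hp).trans ?_
  gcongr
  rw [eLpNorm_enorm]
  have := eLpNorm_const_smul R⁻¹ v p (μ.restrict B)
  rw [← ofReal_norm, Real.norm_eq_abs, abs_of_pos (inv_pos.2 hR)] at this
  exact this.le

/-- For Lipschitz functions of bounded support the chain energy is at most the norm of the local
Lipschitz constant: the slopes at small sizes decrease to it and are uniformly bounded. -/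
theorem chainEnergy_le_eLpNorm_lip {μ : Measure X}
    (hμ : ∀ s : Set X, Bornology.IsBounded s → μ s < ∞) {p : ℝ≥0∞} (hp : p ≠ 0) (hp' : p ≠ ∞)
    {u : X → ℝ} {C : ℝ≥0} (hu : LipschitzWith C u) {x₀ : X} {ρ : ℝ}
    (hsupp : ∀ x ∉ Metric.closedBall x₀ ρ, u x = 0) :
    chainEnergy p μ u ≤ eLpNorm (lip u) p μ := by
  set s := p.toReal with hs
  have hs0 : 0 < s := ENNReal.toReal_pos hp hp'
  have hpow : ∀ f : X → ℝ≥0∞, eLpNorm f p μ = (∫⁻ x, f x ^ s ∂μ) ^ (1 / s) := fun f => by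
    rw [eLpNorm_eq_lintegral_rpow_enorm_toReal hp hp']; rfl
  have hn : ∀ n : ℕ, chainEnergy p μ u ^ s ≤ ∫⁻ x, openSlope (1 / ((n : ℝ) + 1)) u x ^ s ∂μ := by
    intro n
    have hpos : (0 : ℝ) < 1 / ((n : ℝ) + 1) := by positivity
    have h1 : chainEnergy p μ u ≤ eLpNorm (openSlope (1 / ((n : ℝ) + 1)) u) p μ :=
      (iInf₂_le _ (half_pos hpos)).trans (iInf₂_le _
        (isChainUpperGradient_openSlope (half_lt_self hpos) hu.continuous))
    rwa [hpow, one_div s, ENNReal.le_rpow_inv_iff hs0] at h1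
  rw [hpow, one_div s, ENNReal.le_rpow_inv_iff hs0]
  simp only [lip_eq_iInf_openSlope]
  have hinf : ∀ x, (⨅ n : ℕ, openSlope (1 / ((n : ℝ) + 1)) u x) ^ s =
      ⨅ n : ℕ, openSlope (1 / ((n : ℝ) + 1)) u x ^ s := fun x =>
    (ENNReal.orderIsoRpow s hs0).map_iInf _
  simp only [hinf]
  rw [lintegral_iInf (fun n => (measurable_openSlope _ hu.continuous).pow_const s)
    (fun m n h x => ENNReal.rpow_le_rpow (antitone_openSlope u h x) hs0.le) ?_]
  · exact le_iInf hn
  · have hle : ∀ x, openSlope (1 / (((0 : ℕ) : ℝ) + 1)) u x ^ s ≤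
        (Metric.closedBall x₀ (ρ + 1)).indicator (fun _ => (C : ℝ≥0∞) ^ s) x := by
      intro x
      rw [Nat.cast_zero, zero_add, div_one]
      by_cases hx : x ∈ Metric.closedBall x₀ (ρ + 1)
      · rw [Set.indicator_of_mem hx]
        exact ENNReal.rpow_le_rpow ((openSlope_le_slopeAt _ _ _).trans
          (slopeAt_le_of_lipschitzWith hu _ _)) hs0.le
      · rw [Set.indicator_of_notMem hx, openSlope_eq_zero hsupp zero_le_one hx,
          ENNReal.zero_rpow_of_pos hs0]
    refine ((lintegral_mono hle).trans_lt ?_).ne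
    rw [lintegral_indicator_const Metric.isClosed_closedBall.measurableSet]
    exact ENNReal.mul_lt_top (ENNReal.rpow_lt_top_of_nonneg hs0.le ENNReal.coe_ne_top)
      (hμ _ Metric.isBounded_closedBall)

end Cutoff

/-! ### Comparison of the three energies -/

section Comparison

variable {X : Type*} [MetricSpace X] [MeasurableSpace X] [BorelSpace X]

/-- The relaxed chain energy is at most the relaxed energy of the local Lipschitz constant: cutoffs
of a Lipschitz function have bounded support. -/
theorem relaxation_chainEnergy_le_agsEnergy [Nonempty X] {μ : Measure X}
    (hμ : ∀ s : Set X, Bornology.IsBounded s → μ s < ∞) {p : ℝ≥0∞} (hp : 1 ≤ p) (hp' : p < ∞)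
    (u : Lp ℝ p μ) :
    relaxation p μ (chainEnergy p μ) u ≤ relaxation p μ (agsEnergy p μ) u := by
  have hp0 : p ≠ 0 := (zero_lt_one.trans_le hp).ne'
  obtain ⟨x₀⟩ := ‹Nonempty X›
  refine relaxation_le_of_approx hp (fun v hv hF η hη => ?_) u
  obtain ⟨C, hC⟩ : ∃ C, LipschitzWith C v := by
    by_contra h
    rw [agsEnergy, if_neg h] at hF
    exact lt_irrefl _ hF
  have hF' : agsEnergy p μ v = eLpNorm (lip v) p μ := if_pos ⟨C, hC⟩
  have hcont : ∀ k : ℕ, Continuous fun x => cutoff x₀ ((k : ℝ) + 1) x * v x := fun k =>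
    (continuous_cutoff _ _).mul hC.continuous
  have h1 : Tendsto (fun k : ℕ => eLpNorm (fun x => cutoff x₀ ((k : ℝ) + 1) x * v x - v x) p μ)
      atTop (𝓝 0) := by
    refine tendsto_eLpNorm_sub_of_dominated hp0 hp'.ne hv
      (fun k => (hcont k).aestronglyMeasurable) (fun k x => ?_) fun x => ?_
    · rw [abs_mul, abs_of_nonneg (cutoff_nonneg _ _ _)]
      exact mul_le_of_le_one_left (abs_nonneg _) (cutoff_le_one _ _ _)
    · simpa using (tendsto_cutoff x₀ x).mul_const (v x)
  obtain ⟨k, hk1, hk2⟩ := ((h1.eventually_le_const hη).and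
    ((tendsto_ofReal_inv_mul hv.2.ne).eventually_le_const hη)).exists
  have hR : (0 : ℝ) < (k : ℝ) + 1 := by positivity
  refine ⟨fun x => cutoff x₀ ((k : ℝ) + 1) x * v x, ?_, ?_, hk1⟩
  · refine hv.of_le (hcont k).aestronglyMeasurable (Eventually.of_forall fun x => ?_)
    rw [norm_mul, Real.norm_eq_abs, abs_of_nonneg (cutoff_nonneg _ _ _)]
    exact mul_le_of_le_one_left (norm_nonneg _) (cutoff_le_one _ _ _)
  · obtain ⟨C', hC'⟩ := exists_lipschitzWith_cutoff_mul hR x₀ hC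
    refine (chainEnergy_le_eLpNorm_lip hμ hp0 hp'.ne hC' (x₀ := x₀) (ρ := 2 * ((k : ℝ) + 1))
      fun x hx => by rw [cutoff_eq_zero hR hx, zero_mul]).trans ?_
    refine (eLpNorm_lip_cutoff_mul_le hR x₀ hC.continuous hp μ).trans ?_
    rw [hF']
    refine add_le_add (eLpNorm_restrict_le _ _ _ _) (le_trans ?_ hk2)
    exact mul_le_mul_right (eLpNorm_restrict_le _ _ _ _) _

omit [BorelSpace X] in
theorem IsUpperGradientOffPoles.truncate {u : X → ℝ} {g : X → ℝ≥0∞}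
    (h : IsUpperGradientOffPoles u g) (M : ℝ) : IsUpperGradientOffPoles (truncate M u) g := by
  refine ⟨h.1, fun γ a b hγ h0 h1 => le_trans ?_ (h.2 γ a b hγ h0 h1)⟩
  rw [← ofReal_norm, ← ofReal_norm]
  exact ENNReal.ofReal_le_ofReal (abs_truncate_sub_le M u _ _)

/-- Every function with a `p`-integrable upper gradient off poles is approximated in `L^p` by
Lipschitz functions whose energy is almost that of the upper gradient. -/
theorem exists_agsEnergy_le [CompleteSpace X] [TopologicalSpace.SeparableSpace X] [Nonempty X]
    {μ : Measure X} (hμ : ∀ s : Set X, Bornology.IsBounded s → μ s < ∞) {p : ℝ≥0∞} (hp : 1 ≤ p)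
    (hp' : p < ∞) {v : X → ℝ} (hv : MemLp v p μ) {g : X → ℝ≥0∞}
    (hg : IsUpperGradientOffPoles v g) {E : ℝ≥0∞} (hE : eLpNorm g p μ < E) {η : ℝ≥0∞}
    (hη : 0 < η) (hη' : η < ∞) :
    ∃ w : X → ℝ, MemLp w p μ ∧ agsEnergy p μ w ≤ E + η ∧
      eLpNorm (fun x => w x - v x) p μ ≤ η := by
  have hp0 : p ≠ 0 := (zero_lt_one.trans_le hp).ne'
  obtain ⟨x₀⟩ := ‹Nonempty X›
  set f : ℕ → X → ℝ := fun k x => cutoff x₀ ((k : ℝ) + 1) x * truncate k v x with hf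
  have htm : ∀ M : ℝ, AEStronglyMeasurable (truncate M v) μ := fun M =>
    ((hv.1.aemeasurable.min aemeasurable_const).max aemeasurable_const).aestronglyMeasurable
  have h1 : Tendsto (fun k : ℕ => eLpNorm (fun x => f k x - v x) p μ) atTop (𝓝 0) := by
    refine tendsto_eLpNorm_sub_of_dominated hp0 hp'.ne hv
      (fun k => (continuous_cutoff _ _).aestronglyMeasurable.mul (htm k)) (fun k x => ?_) fun x => ?_
    · rw [hf, abs_mul, abs_of_nonneg (cutoff_nonneg _ _ _)]
      exact (mul_le_of_le_one_left (abs_nonneg _) (cutoff_le_one _ _ _)).trans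
        (abs_truncate_le_abs (Nat.cast_nonneg k) v x)
    · have h2 : Tendsto (fun k : ℕ => truncate (k : ℝ) v x) atTop (𝓝 (v x)) := by
        refine tendsto_const_nhds.congr' ?_
        obtain ⟨n, hn⟩ := exists_nat_ge |v x|
        filter_upwards [eventually_ge_atTop n] with k hk
        exact (truncate_eq_self (hn.trans (by exact_mod_cast hk))).symm
      simpa using (tendsto_cutoff x₀ x).mul h2
  have hη2 : 0 < η / 2 := ENNReal.half_pos hη.ne'
  have hfin : eLpNorm v p μ + η / 2 ≠ ∞ :=
    ENNReal.add_ne_top.2 ⟨hv.2.ne, (ENNReal.div_lt_top hη'.ne two_ne_zero).ne⟩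
  obtain ⟨k, hk1, hk2⟩ := ((h1.eventually_le_const hη2).and
    ((tendsto_ofReal_inv_mul hfin).eventually_le_const hη)).exists
  set R : ℝ := (k : ℝ) + 1 with hRdef
  have hR : 0 < R := by positivity
  set B := Metric.closedBall x₀ (2 * R) with hB
  set ν := μ.restrict B with hν
  have hνfin : IsFiniteMeasure ν :=
    ⟨by rw [hν, Measure.restrict_apply_univ]; exact hμ _ Metric.isBounded_closedBall⟩
  obtain ⟨w, ⟨C, hC⟩, hwE, hwη⟩ := exists_lipschitz_approx ν hp hp'
    (htm k).aemeasurable.restrict (abs_truncate_le (Nat.cast_nonneg k) v) (hg.truncate k)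
    ((eLpNorm_restrict_le g p μ B).trans_lt hE) hη2.ne'
  have hcw : Continuous fun x => cutoff x₀ R x * w x := (continuous_cutoff _ _).mul hC.continuous
  have hwv : eLpNorm (fun x => cutoff x₀ R x * w x - v x) p μ ≤ η := by
    have hsplit : (fun x => cutoff x₀ R x * w x - v x) =
        (fun x => cutoff x₀ R x * (w x - truncate k v x)) + fun x => f k x - v x := by
      ext x
      simp only [hf, Pi.add_apply]
      ring
    rw [hsplit, ← ENNReal.add_halves η]
    refine (eLpNorm_add_le ((continuous_cutoff _ _).aestronglyMeasurable.mul
      (hC.continuous.aestronglyMeasurable.sub (htm k)))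
      (((continuous_cutoff _ _).aestronglyMeasurable.mul (htm k)).sub hv.1) hp).trans
      (add_le_add (le_trans ?_ hwη) hk1)
    rw [← eLpNorm_indicator_eq_eLpNorm_restrict Metric.isClosed_closedBall.measurableSet]
    refine eLpNorm_mono fun x => ?_
    simp only [Pi.mul_apply, Pi.sub_apply]
    by_cases hx : x ∈ B
    · rw [Set.indicator_of_mem hx, norm_mul, Real.norm_eq_abs,
        abs_of_nonneg (cutoff_nonneg _ _ _)]
      exact mul_le_of_le_one_left (norm_nonneg _) (cutoff_le_one _ _ _)
    · rw [cutoff_eq_zero hR hx, zero_mul, norm_zero]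
      exact norm_nonneg _
  refine ⟨fun x => cutoff x₀ R x * w x, ?_, ?_, hwv⟩
  · have : MemLp (fun x => cutoff x₀ R x * w x - v x) p μ :=
      ⟨hcw.aestronglyMeasurable.sub hv.1, hwv.trans_lt hη'⟩
    have h2 := this.add hv
    convert h2 using 1
    ext x
    simp
  · rw [agsEnergy, if_pos (exists_lipschitzWith_cutoff_mul hR x₀ hC)]
    refine (eLpNorm_lip_cutoff_mul_le hR x₀ hC.continuous hp μ).trans (add_le_add hwE ?_)
    refine le_trans ?_ hk2
    gcongr
    have hsplit : w = (fun x => w x - truncate k v x) + truncate k v := by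
      ext x; simp
    rw [hsplit, add_comm (eLpNorm v p μ)]
    refine (eLpNorm_add_le (hC.continuous.aestronglyMeasurable.sub (htm k).restrict)
      (htm k).restrict hp).trans (add_le_add hwη ?_)
    exact (eLpNorm_restrict_le _ _ _ _).trans
      (eLpNorm_mono fun x => abs_truncate_le_abs (Nat.cast_nonneg k) v x)

/-- The relaxed energy of the local Lipschitz constant is at most any relaxed energy that is almost
attained by upper gradients off poles. -/
theorem relaxation_agsEnergy_le [CompleteSpace X] [TopologicalSpace.SeparableSpace X] [Nonempty X]
    {μ : Measure X} (hμ : ∀ s : Set X, Bornology.IsBounded s → μ s < ∞) {p : ℝ≥0∞} (hp : 1 ≤ p)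
    (hp' : p < ∞) {F : (X → ℝ) → ℝ≥0∞}
    (hF : ∀ v : X → ℝ, ∀ c, F v < c → ∃ g, IsUpperGradientOffPoles v g ∧ eLpNorm g p μ < c)
    (u : Lp ℝ p μ) :
    relaxation p μ (agsEnergy p μ) u ≤ relaxation p μ F u := by
  refine relaxation_le_of_approx hp (fun v hv hFv η hη => ?_) u
  set e := min η 1 / 2 with he
  have he0 : 0 < e := ENNReal.half_pos (lt_min hη zero_lt_one).ne'
  have he' : e < ∞ :=
    ENNReal.div_lt_top ((min_le_right _ _).trans_lt ENNReal.one_lt_top).ne two_ne_zero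
  have hee : e + e ≤ η := by
    rw [he, ENNReal.add_halves]
    exact min_le_left _ _
  obtain ⟨g, hg, hgc⟩ := hF v (F v + e) (ENNReal.lt_add_right hFv.ne he0.ne')
  obtain ⟨w, hw, hwE, hwv⟩ := exists_agsEnergy_le hμ hp hp' hv hg hgc he0 he'
  refine ⟨w, hw, hwE.trans ?_, hwv.trans (le_self_add.trans hee)⟩
  rw [add_assoc]
  gcongr

theorem relaxation_chainEnergy_eq_agsEnergy [CompleteSpace X] [TopologicalSpace.SeparableSpace X]
    [Nonempty X] {μ : Measure X} (hμ : ∀ s : Set X, Bornology.IsBounded s → μ s < ∞) {p : ℝ≥0∞}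
    (hp : 1 ≤ p) (hp' : p < ∞) (u : Lp ℝ p μ) :
    relaxation p μ (chainEnergy p μ) u = relaxation p μ (agsEnergy p μ) u := by
  refine le_antisymm (relaxation_chainEnergy_le_agsEnergy hμ hp hp' u)
    (relaxation_agsEnergy_le hμ hp hp' (fun v c hc => ?_) u)
  simp only [chainEnergy, chainEnergyAt, iInf_lt_iff] at hc
  obtain ⟨ε, hε, g, hg, hgc⟩ := hc
  exact ⟨g, hg.isUpperGradientOffPoles hε, hgc⟩

theorem relaxation_agsEnergy_eq_curveEnergy [CompleteSpace X] [TopologicalSpace.SeparableSpace X]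
    [Nonempty X] {μ : Measure X} (hμ : ∀ s : Set X, Bornology.IsBounded s → μ s < ∞) {p : ℝ≥0∞}
    (hp : 1 ≤ p) (hp' : p < ∞) (u : Lp ℝ p μ) :
    relaxation p μ (agsEnergy p μ) u = relaxation p μ (curveEnergy p μ) u := by
  refine le_antisymm (relaxation_agsEnergy_le hμ hp hp' (fun v c hc => ?_) u)
    (relaxation_le_of_approx hp (fun v hv _ η _ =>
      ⟨v, hv, (curveEnergy_le_agsEnergy p μ v).trans le_self_add, by simp⟩) u)
  simp only [curveEnergy, iInf_lt_iff] at hc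
  obtain ⟨g, hg, hgc⟩ := hc
  exact ⟨g, hg.isUpperGradientOffPoles, hgc⟩

end Comparison

end ChainSobolev

theorem theorem1p1 {X : Type*} [MetricSpace X] [CompleteSpace X]
    [TopologicalSpace.SeparableSpace X] [MeasurableSpace X] [BorelSpace X]
    (μ : Measure X) (hμ_ne : μ ≠ 0)
    (hμ_fin : ∀ s : Set X, Bornology.IsBounded s → μ s < ∞)
    (p : ℝ≥0∞) (hp_one : 1 ≤ p) (hp_top : p < ∞) :
    (ChainSobolev.sobolevSpace p μ (ChainSobolev.chainEnergy p μ) =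
        ChainSobolev.sobolevSpace p μ (ChainSobolev.agsEnergy p μ) ∧
      ChainSobolev.sobolevSpace p μ (ChainSobolev.agsEnergy p μ) =
        ChainSobolev.sobolevSpace p μ (ChainSobolev.curveEnergy p μ)) ∧
    ∀ u : Lp ℝ p μ,
      ChainSobolev.sobolevNorm p μ (ChainSobolev.chainEnergy p μ) u =
        ChainSobolev.sobolevNorm p μ (ChainSobolev.agsEnergy p μ) u ∧
      ChainSobolev.sobolevNorm p μ (ChainSobolev.agsEnergy p μ) u =
        ChainSobolev.sobolevNorm p μ (ChainSobolev.curveEnergy p μ) u := by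
  have hX : Nonempty X := by
    by_contra h
    rw [not_nonempty_iff] at h
    exact hμ_ne (Measure.eq_zero_of_isEmpty μ)
  have h1 := ChainSobolev.relaxation_chainEnergy_eq_agsEnergy hμ_fin hp_one hp_top
  have h2 := ChainSobolev.relaxation_agsEnergy_eq_curveEnergy hμ_fin hp_one hp_top
  refine ⟨⟨?_, ?_⟩, fun u => ⟨?_, ?_⟩⟩
  · simp only [ChainSobolev.sobolevSpace, h1]
  · simp only [ChainSobolev.sobolevSpace, h2]
  · simp only [ChainSobolev.sobolevNorm, h1]
  · simp only [ChainSobolev.sobolevNorm, h2]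

end
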